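/- Fix $d\in\mathbb{N}$. Let $\mathcal{P}_2(\mathbb{R}^d)$ be the set of Borel probability measures on $\mathbb{R}^d$ with finite second moment. For $\mu,\nu\in\mathcal{P}_2(\mathbb{R}^d)$ let $\Pi(\mu,\nu)$ be the set of couplings of $\mu$ and $\nu$, and define the inner product Gromov--Wasserstein distance $$\mathsf{IGW}(\mu,\nu)=\Big(\inf_{\pi\in\Pi(\mu,\nu)}\iint\big|\langle x,x'\rangle-\langle y,y'\rangle\big|^2\,d\pi\otimes\pi(x,y,x',y')\Big)^{1/2}.$$ Let $\mathrm{Lip}_{\mathsf{IGW}}$ be the set of curves $\rho:[0,1]\to\mathcal{P}_2(\mathbb{R}^d)$ for which there is $L\ge 0$ with $\mathsf{IGW}(\rho_s,\rho_t)\le L|s-t|$ for all $s,t\in[0,1]$. The length of such a curve is $$\ell_{\mathsf{IGW}}(\rho)=\sup_{0=t_0<t_1<\dots<t_n=1}\ \sum_{i=1}^n\mathsf{IGW}(\rho_{t_{i-1}},\rho_{t_i}),$$ the supremum being over all finite partitions of $[0,1]$, and the intrinsic metric is $$\mathsf{d}_{\mathsf{IGW}}(\mu_0,\mu_1)=\inf\big\{\ell_{\mathsf{IGW}}(\rho):\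 \rho\in\mathrm{Lip}_{\mathsf{IGW}},\ \rho_0=\mu_0,\ \rho_1=\mu_1\big\}.$$ Write $\mathbf{\Sigma}_\mu=\int xx^{\intercal}\,d\mu(x)$ for the (uncentered) covariance matrix of $\mu$. **Theorem (Pseudometric, geodesics, and continuity).** 1. $\mathsf{d}_{\mathsf{IGW}}$ is a pseudometric on $\mathcal{P}_2(\mathbb{R}^d)$ (in particular it is finite), and for all $\mu_0,\mu_1\in\mathcal{P}_2(\mathbb{R}^d)$ we have $\mathsf{d}_{\mathsf{IGW}}(\mu_0,\mu_1)=0$ if and only if $\mathsf{IGW}(\mu_0,\mu_1)=0$. 2. $(\mathcal{P}_2(\mathbb{R}^d),\mathsf{d}_{\mathsf{IGW}})$ is a geodesic space: for all $\mu_0,\mu_1\in\mathcal{P}_2(\mathbb{R}^d)$ there exists $\rho\in\mathrm{Lip}_{\mathsf{IGW}}$ with $\rho_0=\mu_0$, $\rho_1=\mu_1$ and $\ell_{\mathsf{IGW}}(\rho)=\mathsf{d}_{\mathsf{IGW}}(\mu_0,\mu_1)$, and $\rho$ may be chosen so that, moreover, $\mathsf{d}_{\mathsf{IGW}}(\rho_s,\rho_t)=|s-t|\,\mathsf{d}_{\mathsf{IGW}}(\mu_0,\mu_1)$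 for all $s,t\in[0,1]$. 3. $\mathsf{d}_{\mathsf{IGW}}$ is continuous with respect to $\mathsf{IGW}$ at measures with nonsingular covariance matrix: if $\mu_0\in\mathcal{P}_2(\mathbb{R}^d)$ and $\lambda_{\min}(\mathbf{\Sigma}_{\mu_0})>0$ (that is, $\mathbf{\Sigma}_{\mu_0}$ is positive definite), then $$\lim_{\mathsf{IGW}(\mu,\mu_0)\to 0}\mathsf{d}_{\mathsf{IGW}}(\mu,\mu_0)=0,$$ i.e. for every $\varepsilon>0$ there is $\delta>0$ such that every $\mu\in\mathcal{P}_2(\mathbb{R}^d)$ with $\mathsf{IGW}(\mu,\mu_0)<\delta$ satisfies $\mathsf{d}_{\mathsf{IGW}}(\mu,\mu_0)<\varepsilon$. -/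

import Mathlib

open MeasureTheory Filter Topology
open scoped NNReal ENNReal unitInterval

noncomputable section

/-- The space `P_2(ℝ^d)` of Borel probability measures on Euclidean space with finite second
moment. -/
abbrev P2 (d : ℕ) : Type :=
  {μ : ProbabilityMeasure (EuclideanSpace ℝ (Fin d)) //
    ∫⁻ x, ‖x‖ₑ ^ 2 ∂(μ : Measure (EuclideanSpace ℝ (Fin d))) < ∞}

/-- The couplings of `μ` and `ν`: probability measures on the product with marginals `μ`, `ν`. -/
def couplings {d : ℕ} (μ ν : ProbabilityMeasure (EuclideanSpace ℝ (Fin d))) :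
    Set (ProbabilityMeasure (EuclideanSpace ℝ (Fin d) × EuclideanSpace ℝ (Fin d))) :=
  {π | Measure.map Prod.fst (π : Measure (EuclideanSpace ℝ (Fin d) × EuclideanSpace ℝ (Fin d)))
        = (μ : Measure (EuclideanSpace ℝ (Fin d))) ∧
      Measure.map Prod.snd (π : Measure (EuclideanSpace ℝ (Fin d) × EuclideanSpace ℝ (Fin d)))
        = (ν : Measure (EuclideanSpace ℝ (Fin d)))}

/-- The distortion `∬ |⟨x, x'⟩ - ⟨y, y'⟩|² dπ⊗π(x, y, x', y')` of a coupling; the integration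
variable is `z = ((x, y), (x', y'))`. -/
def igwCost {d : ℕ}
    (π : ProbabilityMeasure (EuclideanSpace ℝ (Fin d) × EuclideanSpace ℝ (Fin d))) : ℝ≥0∞ :=
  ∫⁻ z, ENNReal.ofReal (|inner ℝ z.1.1 z.2.1 - inner ℝ z.1.2 z.2.2| ^ 2)
    ∂((π : Measure (EuclideanSpace ℝ (Fin d) × EuclideanSpace ℝ (Fin d))).prod
      (π : Measure (EuclideanSpace ℝ (Fin d) × EuclideanSpace ℝ (Fin d))))

/-- The inner product Gromov-Wasserstein distance. -/
def IGW {d : ℕ} (μ ν : P2 d) : ℝ≥0∞ :=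
  (⨅ π ∈ couplings μ.1 ν.1, igwCost π) ^ (1 / 2 : ℝ)

/-- Curves `[0,1] → P_2(ℝ^d)` that are Lipschitz with respect to `IGW`. -/
def LipIGW {d : ℕ} (ρ : I → P2 d) : Prop :=
  ∃ L : ℝ≥0, ∀ s t : I, IGW (ρ s) (ρ t) ≤ L * edist s t

/-- The `IGW` length of a curve: the supremum over partitions `0 = t₀ < t₁ < ⋯ < tₙ = 1` of
`∑ i, IGW (ρ tᵢ₋₁) (ρ tᵢ)`. -/
def lengthIGW {d : ℕ} (ρ : I → P2 d) : ℝ≥0∞ :=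
  ⨆ (n : ℕ) (t : Fin (n + 1) → I) (_ : StrictMono t) (_ : t 0 = 0) (_ : t (Fin.last n) = 1),
    ∑ i : Fin n, IGW (ρ (t i.castSucc)) (ρ (t i.succ))

/-- The intrinsic metric: the infimum of the lengths of `IGW`-Lipschitz curves joining two
measures. -/
def dIGW {d : ℕ} (μ ν : P2 d) : ℝ≥0∞ :=
  ⨅ (ρ : I → P2 d) (_ : LipIGW ρ) (_ : ρ 0 = μ) (_ : ρ 1 = ν), lengthIGW ρ

/-- The (uncentered) covariance matrix `∫ x xᵀ dμ(x)`. -/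
def covMatrix {d : ℕ} (μ : P2 d) : Matrix (Fin d) (Fin d) ℝ :=
  Matrix.of fun i j => ∫ x, x i * x j ∂(μ.1 : Measure (EuclideanSpace ℝ (Fin d)))

end

/-! Gluing couplings makes `IGW` a pseudometric; the pseudometric properties of `dIGW`, apart from
finiteness, are then general metric geometry. A Lipschitz curve of length at most `c > 0` has a
1-Lipschitz arc-length reparametrization on an interval of length `c`
(`unitSpeedJoined_of_curveLength_le`); reversing and concatenating such curves gives symmetry and
the triangle inequality. Finiteness comes from segments of random vectors (`dIGW_le_eLpNorm`).

Geodesics come from the direct method (`exists_geodesic_of_generalizedLimit`): near-minimizers are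
rescaled to `[0,1]` and their limits are taken at all times along one ultrafilter. Compactness holds
because `IGW` balls have bounded second moments (`exists_moment_bound`) and are therefore tight;
`IGW` is lower semicontinuous along narrow limits with bounded moments (`IGW_le_of_tendsto`).

For continuity, couple `X ∼ μ₀` and `Y ∼ μ` with Gram kernels close in `L²`. Integrating the kernel
difference against an independent copy of `X` gives `ΣX - E[XYᵀ]Y`, so for nonsingular `Σ` the
vector `X` is `L²`-close to `TY` with `T = Σ⁻¹E[XYᵀ]`. From `Y` to `TY` one interpolates Gram
kernels, which stay Gram kernels of linear images of `Y`; the cost is the Gram distance, with no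
bound on `T` needed. From `TY` to `X` a segment suffices. -/

/-! ### Intrinsic distances in pseudo-extended-metric spaces -/

section Intrinsic

variable {X : Type*} [PseudoEMetricSpace X]

/-- The length of a curve parametrized by the unit interval. -/
noncomputable def curveLength (ρ : I → X) : ℝ≥0∞ :=
  ⨆ (n : ℕ) (t : Fin (n + 1) → I) (_ : StrictMono t) (_ : t 0 = 0) (_ : t (Fin.last n) = 1),
    ∑ i : Fin n, edist (ρ (t i.castSucc)) (ρ (t i.succ))

/-- The infimum of the lengths of Lipschitz curves joining two points. -/
noncomputable def intrinsicEDist (x y : X) : ℝ≥0∞ :=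
  ⨅ (ρ : I → X) (_ : ∃ L : ℝ≥0, ∀ s t : I, edist (ρ s) (ρ t) ≤ L * edist s t) (_ : ρ 0 = x)
    (_ : ρ 1 = y), curveLength ρ

/-- Two points are joined by a 1-Lipschitz curve that is at `x` at time `0` and at `y` at
time `c`. -/
def UnitSpeedJoined (x y : X) (c : ℝ) : Prop :=
  ∃ f : ℝ → X, LipschitzWith 1 f ∧ f 0 = x ∧ f c = y

theorem intrinsicEDist_le_curveLength {ρ : I → X} {L : ℝ≥0} (hL : LipschitzWith L ρ) :
    intrinsicEDist (ρ 0) (ρ 1) ≤ curveLength ρ :=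
  iInf_le_of_le ρ (iInf_le_of_le ⟨L, hL⟩ (iInf_le_of_le rfl (iInf_le_of_le rfl le_rfl)))

theorem edist_le_curveLength (ρ : I → X) : edist (ρ 0) (ρ 1) ≤ curveLength ρ := by
  refine le_iSup_of_le 1 (le_iSup_of_le ![0, 1] (le_iSup_of_le ?_ (le_iSup_of_le (by simp)
    (le_iSup_of_le (by simp) ?_))))
  · intro i j h
    fin_cases i <;> fin_cases j <;> simp_all
  · simp

theorem edist_le_intrinsicEDist (x y : X) : edist x y ≤ intrinsicEDist x y := by
  refine le_iInf fun ρ => le_iInf fun _ => le_iInf fun h0 => le_iInf fun h1 => ?_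
  rw [← h0, ← h1]
  exact edist_le_curveLength ρ

theorem curveLength_le_of_lipschitzWith {ρ : I → X} {c : ℝ≥0} (h : LipschitzWith c ρ) :
    curveLength ρ ≤ c := by
  refine iSup_le fun n => iSup_le fun t => iSup_le fun ht => iSup_le fun h0 => iSup_le fun h1 => ?_
  calc ∑ i : Fin n, edist (ρ (t i.castSucc)) (ρ (t i.succ))
      ≤ ∑ i : Fin n, (c : ℝ≥0∞) * ENNReal.ofReal ((t i.succ : ℝ) - t i.castSucc) := by
        refine Finset.sum_le_sum fun i _ => (h _ _).trans_eq ?_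
        have : (t i.castSucc : ℝ) ≤ t i.succ := ht.monotone (Fin.castSucc_le_succ i)
        rw [edist_comm, Subtype.edist_eq, edist_dist, Real.dist_eq, abs_of_nonneg (by linarith)]
    _ = c * ENNReal.ofReal (∑ i : Fin n, ((t i.succ : ℝ) - t i.castSucc)) := by
        rw [← Finset.mul_sum, ENNReal.ofReal_sum_of_nonneg]
        intro i _
        exact sub_nonneg.2 (ht.monotone (Fin.castSucc_le_succ i))
    _ = c := by
        have : ∑ i : Fin n, ((t i.succ : ℝ) - t i.castSucc) = 1 := by
          rw [Finset.sum_sub_distrib]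
          have e1 := Fin.sum_univ_succ (fun i => (t i : ℝ))
          have e2 := Fin.sum_univ_castSucc (fun i => (t i : ℝ))
          rw [h0] at e1; rw [h1] at e2
          simp only [Set.Icc.coe_zero, Set.Icc.coe_one] at e1 e2
          linarith
        rw [this]; simp

/-- `eVariationOn` samples along any monotone sequence, `curveLength` only along strict partitions
containing both endpoints. Adjoining `0` and `1` to the sampled points and sorting gives such a
partition, and refinement can only increase the sum. -/
theorem eVariationOn_univ_le_curveLength (ρ : I → X) :
    eVariationOn ρ Set.univ ≤ curveLength ρ := by
  classical
  refine iSup_le ?_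
  rintro ⟨n, u, hu, -⟩
  set S : Finset I := (Finset.range (n + 1)).image u ∪ {0, 1} with hS
  have h0S : (0 : I) ∈ S := by simp [hS]
  have h1S : (1 : I) ∈ S := by simp [hS]
  obtain ⟨m, hm⟩ : ∃ m, S.card = m + 1 :=
    Nat.exists_eq_succ_of_ne_zero (Finset.card_ne_zero_of_mem h0S)
  set t : Fin (m + 1) ↪o I := S.orderEmbOfFin hm with ht
  have hrange : Set.range t = S := Finset.range_orderEmbOfFin S hm
  have ht0 : t 0 = 0 := by
    obtain ⟨i, hi⟩ : (0 : I) ∈ Set.range t := hrange ▸ h0S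
    exact le_antisymm (hi ▸ t.monotone (Fin.zero_le i)) (unitInterval.nonneg' )
  have ht1 : t (Fin.last m) = 1 := by
    obtain ⟨i, hi⟩ : (1 : I) ∈ Set.range t := hrange ▸ h1S
    exact le_antisymm unitInterval.le_one' (hi ▸ t.monotone (Fin.le_last i))
  have hsum : ∑ i ∈ Finset.range n, edist (ρ (u (i + 1))) (ρ (u i)) =
      eVariationOn ρ (u '' Set.Iic n) := by
    rw [eVariationOn.image_range_of_monotone ρ hu]
    exact Finset.sum_congr rfl fun i _ => edist_comm _ _
  -- Extended past index `m` by its last value, to fit lemmas about sequences on `ℕ`.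
  let v : ℕ → I := fun k => t ⟨min k m, by omega⟩
  have hv : Monotone v := fun a b hab => t.monotone (by
    simp only [Fin.mk_le_mk]; omega)
  have hsum' : ∑ i : Fin m, edist (ρ (t i.castSucc)) (ρ (t i.succ)) =
      eVariationOn ρ (v '' Set.Iic m) := by
    rw [eVariationOn.image_range_of_monotone ρ hv, Finset.sum_range]
    refine Finset.sum_congr rfl fun i _ => ?_
    have e1 : v i = t i.castSucc := by
      simp only [v]; congr 1; ext; simp
    have e2 : v (i + 1) = t i.succ := by
      simp only [v]; congr 1; ext; simp
    rw [e1, e2]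
  calc ∑ i ∈ Finset.range n, edist (ρ (u (i + 1))) (ρ (u i))
      = eVariationOn ρ (u '' Set.Iic n) := hsum
    _ ≤ eVariationOn ρ (v '' Set.Iic m) := by
        refine eVariationOn.mono _ ?_
        rintro _ ⟨k, hk, rfl⟩
        obtain ⟨i, hi⟩ : u k ∈ Set.range t := by
          rw [hrange]; simp only [hS, Finset.coe_union, Finset.coe_image]
          exact Or.inl ⟨k, by simpa [Nat.lt_succ_iff] using hk, rfl⟩
        refine ⟨i, Nat.lt_succ_iff.1 i.2, ?_⟩
        rw [← hi]; simp only [v]; congr 1; ext; simp; omega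
    _ ≤ curveLength ρ := by
        rw [← hsum']
        exact le_iSup_of_le m (le_iSup_of_le t (le_iSup_of_le t.strictMono
          (le_iSup_of_le ht0 (le_iSup_of_le ht1 le_rfl))))

theorem UnitSpeedJoined.symm {x y : X} {c : ℝ} (h : UnitSpeedJoined x y c) :
    UnitSpeedJoined y x c := by
  obtain ⟨f, hf, h0, hc⟩ := h
  refine ⟨fun t => f (c - t), fun s t => (hf _ _).trans ?_, by simpa using hc, by simpa using h0⟩
  simp [edist_sub_left]

theorem UnitSpeedJoined.trans {x y z : X} {a b : ℝ} (ha : 0 < a) (hb : 0 < b)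
    (h : UnitSpeedJoined x y a) (h' : UnitSpeedJoined y z b) : UnitSpeedJoined x z (a + b) := by
  obtain ⟨f, hf, f0, fa⟩ := h
  obtain ⟨g, hg, g0, gb⟩ := h'
  have key : ∀ s t : ℝ, s ≤ t → edist (if s ≤ a then f s else g (s - a))
      (if t ≤ a then f t else g (t - a)) ≤ (1 : ℝ≥0) * edist s t := by
    intro s t hst
    split_ifs with h1 h2 h2
    · exact hf s t
    · refine (edist_triangle _ (f a) _).trans ?_
      have e1 := hf s a
      have e2 := hg 0 (t - a)
      rw [g0, ← fa] at e2
      refine (add_le_add e1 e2).trans_eq ?_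
      simp only [ENNReal.coe_one, one_mul, edist_dist, Real.dist_eq]
      rw [← ENNReal.ofReal_add (abs_nonneg _) (abs_nonneg _)]
      rw [abs_of_nonpos, abs_of_nonpos, abs_of_nonpos]
      · ring_nf
      all_goals linarith
    · linarith
    · refine (hg _ _).trans_eq ?_
      simp [edist_sub_right]
  refine ⟨fun t => if t ≤ a then f t else g (t - a), fun s t => ?_, ?_, ?_⟩
  · rcases le_total s t with hst | hst
    · exact key s t hst
    · rw [edist_comm, edist_comm s]
      exact key t s hst
  · simp [ha.le, f0]
  · have : ¬ (a + b ≤ a) := by linarith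
    simp [this, gb]

theorem intrinsicEDist_le_of_unitSpeedJoined {x y : X} {c : ℝ≥0}
    (h : UnitSpeedJoined x y c) : intrinsicEDist x y ≤ c := by
  obtain ⟨f, hf, h0, hc⟩ := h
  have hL : LipschitzWith c (fun t : I => f (c * t)) := by
    intro s t
    refine (hf _ _).trans_eq ?_
    rw [Subtype.edist_eq]
    simp only [edist_dist, Real.dist_eq, ENNReal.coe_one, one_mul, ← mul_sub, abs_mul,
      NNReal.abs_eq]
    rw [ENNReal.ofReal_mul c.coe_nonneg, ENNReal.ofReal_coe_nnreal]
  simpa [h0, hc] using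
    (intrinsicEDist_le_curveLength hL).trans (curveLength_le_of_lipschitzWith hL)

/-- Arc-length reparametrization. With `φ` the variation from `0`, the distance between `ρ s` and `ρ
t` is at most `|φ s - φ t|`, so composing `ρ` with any right inverse of `φ` is 1-Lipschitz. -/
theorem unitSpeedJoined_of_curveLength_le {ρ : I → X} {L : ℝ≥0} (hL : LipschitzWith L ρ)
    {c : ℝ} (hc : 0 < c) (h : curveLength ρ ≤ ENNReal.ofReal c) :
    UnitSpeedJoined (ρ 0) (ρ 1) c := by
  have hV : eVariationOn ρ Set.univ ≤ ENNReal.ofReal c :=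
    (eVariationOn_univ_le_curveLength ρ).trans h
  have hbv : BoundedVariationOn ρ Set.univ := (hV.trans_lt ENNReal.ofReal_lt_top).ne
  have hlbv := hbv.locallyBoundedVariationOn
  set φ : I → ℝ := variationOnFromTo ρ Set.univ 0
  have hsub : ∀ s t, φ t - φ s = variationOnFromTo ρ Set.univ s t := fun s t =>
    variationOnFromTo.sub_right hlbv (Set.mem_univ _) (Set.mem_univ _) (Set.mem_univ _)
  have hφ0 : φ 0 = 0 := variationOnFromTo.self _ _ _
  have hmono : Monotone φ := fun s t hst => by
    rw [← sub_nonneg, hsub]; exact variationOnFromTo.nonneg_of_le _ _ hst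
  -- Serves only to make `φ` continuous, so that the intermediate value theorem provides the right
  -- inverse.
  have hupper : ∀ s t, s ≤ t → φ t - φ s ≤ L * ((t : ℝ) - s) := by
    intro s t hst
    have hst' : (0 : ℝ) ≤ t - s := sub_nonneg.2 hst
    rw [hsub, variationOnFromTo.eq_of_le _ _ hst]
    refine ENNReal.toReal_le_of_le_ofReal (by positivity) ?_
    have e1 := hL.lipschitzOnWith.comp_eVariationOn_le (t := Set.univ) (g := id)
      (s := Set.univ ∩ Set.Icc s t) (Set.mapsTo_univ _ _)
    have e2 : eVariationOn (id : I → I) (Set.univ ∩ Set.Icc s t) ≤ ENNReal.ofReal ((t : ℝ) - s) :=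
      (MonotoneOn.eVariationOn_eq (f := fun x : I => (x : ℝ)) (fun a _ b _ h => h)
        (Set.mem_univ s) (Set.mem_univ t)).le
    refine e1.trans ((mul_le_mul_right e2 _).trans_eq ?_)
    rw [ENNReal.ofReal_mul L.coe_nonneg, ENNReal.ofReal_coe_nnreal]
  have hcont : Continuous φ := by
    refine (LipschitzWith.of_dist_le_mul (K := L) fun s t => ?_).continuous
    rw [Real.dist_eq, Subtype.dist_eq, Real.dist_eq]
    rcases le_total s t with hst | hst
    · rw [abs_sub_comm, abs_of_nonneg (sub_nonneg.2 (hmono hst)), abs_sub_comm,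
        abs_of_nonneg (sub_nonneg.2 (Subtype.coe_le_coe.2 hst))]
      exact hupper s t hst
    · rw [abs_of_nonneg (sub_nonneg.2 (hmono hst)),
        abs_of_nonneg (sub_nonneg.2 (Subtype.coe_le_coe.2 hst))]
      exact hupper t s hst
  have hlower : ∀ s t, s ≤ t → edist (ρ s) (ρ t) ≤ ENNReal.ofReal (φ t - φ s) := by
    intro s t hst
    rw [hsub, variationOnFromTo.eq_of_le _ _ hst, ENNReal.ofReal_toReal (hlbv s t trivial trivial)]
    exact eVariationOn.edist_le _ ⟨trivial, le_rfl, hst⟩ ⟨trivial, hst, le_rfl⟩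
  have hlower' : ∀ s t, edist (ρ s) (ρ t) ≤ edist (φ s) (φ t) := by
    intro s t
    rcases le_total s t with hst | hst
    · rw [edist_comm (φ s), edist_dist, Real.dist_eq, abs_of_nonneg (sub_nonneg.2 (hmono hst))]
      exact hlower s t hst
    · rw [edist_comm, edist_dist, Real.dist_eq, abs_of_nonneg (sub_nonneg.2 (hmono hst))]
      exact hlower t s hst
  set V := φ 1
  have hV0 : 0 ≤ V := hφ0 ▸ hmono unitInterval.nonneg'
  have hVc : V ≤ c := by
    have : V = variationOnFromTo ρ Set.univ 0 1 := rfl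
    rw [this, variationOnFromTo.eq_of_le _ _ unitInterval.nonneg']
    exact ENNReal.toReal_le_of_le_ofReal hc.le ((eVariationOn.mono _ Set.inter_subset_left).trans hV)
  have hproj : ∀ u : ℝ, ∃ τ : I, φ τ = Set.projIcc 0 V hV0 u := by
    intro u
    have := intermediate_value_univ (0 : I) 1 hcont
    rw [hφ0] at this
    exact this (Set.projIcc 0 V hV0 u).2
  choose τ hτ using hproj
  -- `φ` may be flat near the ends, so `τ` need not hit `0` or `1`; in a pseudometric space the
  -- exact endpoints must be imposed by hand. This leaves `φ ∘ ζ` unchanged.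
  let ζ : ℝ → I := fun u => if u ≤ 0 then 0 else if c ≤ u then 1 else τ u
  have hζ : ∀ u, φ (ζ u) = Set.projIcc 0 V hV0 u := by
    intro u
    simp only [ζ]
    split_ifs with h1 h2
    · rw [Set.projIcc_of_le_left hV0 h1, hφ0]
    · rw [Set.projIcc_of_right_le hV0 (hVc.trans h2)]
    · exact hτ u
  refine ⟨fun u => ρ (ζ u), fun s t => (hlower' _ _).trans ?_, ?_, ?_⟩
  · rw [hζ, hζ]
    exact LipschitzWith.projIcc hV0 s t
  · simp [ζ]
  · simp [ζ, hc.not_ge]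

theorem unitSpeedJoined_of_intrinsicEDist_lt {x y : X} {c : ℝ}
    (h : intrinsicEDist x y < ENNReal.ofReal c) : UnitSpeedJoined x y c := by
  have hc : 0 < c := ENNReal.ofReal_pos.1 (zero_le.trans_lt h)
  simp only [intrinsicEDist, iInf_lt_iff] at h
  obtain ⟨ρ, ⟨L, hL⟩, rfl, rfl, h⟩ := h
  exact unitSpeedJoined_of_curveLength_le (L := L) hL hc h.le

theorem intrinsicEDist_comm (x y : X) : intrinsicEDist x y = intrinsicEDist y x := by
  have key : ∀ x y : X, intrinsicEDist x y ≤ intrinsicEDist y x := by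
    intro x y
    refine le_of_forall_gt fun c hc => ?_
    obtain ⟨r, hr, hrc⟩ := ENNReal.lt_iff_exists_nnreal_btwn.1 hc
    rw [← ENNReal.ofReal_coe_nnreal] at hr
    exact (intrinsicEDist_le_of_unitSpeedJoined
      (unitSpeedJoined_of_intrinsicEDist_lt hr).symm).trans_lt hrc
  exact le_antisymm (key x y) (key y x)

theorem intrinsicEDist_triangle (x y z : X) :
    intrinsicEDist x z ≤ intrinsicEDist x y + intrinsicEDist y z := by
  refine ENNReal.le_of_forall_pos_le_add fun ε hε hfin => ?_
  obtain ⟨h1, h2⟩ := ENNReal.add_lt_top.1 hfin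
  lift intrinsicEDist x y to ℝ≥0 using h1.ne with a ha
  lift intrinsicEDist y z to ℝ≥0 using h2.ne with b hb
  have hε2 : 0 < ε / 2 := half_pos hε
  have k1 : UnitSpeedJoined x y ((a + ε / 2 : ℝ≥0) : ℝ) := by
    apply unitSpeedJoined_of_intrinsicEDist_lt
    rw [← ha, ENNReal.ofReal_coe_nnreal]
    exact_mod_cast lt_add_of_pos_right a hε2
  have k2 : UnitSpeedJoined y z ((b + ε / 2 : ℝ≥0) : ℝ) := by
    apply unitSpeedJoined_of_intrinsicEDist_lt
    rw [← hb, ENNReal.ofReal_coe_nnreal]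
    exact_mod_cast lt_add_of_pos_right b hε2
  have k3 := k1.trans (by positivity) (by positivity) k2
  rw [← NNReal.coe_add] at k3
  refine (intrinsicEDist_le_of_unitSpeedJoined k3).trans_eq ?_
  rw [← ENNReal.coe_add, ← ENNReal.coe_add, ENNReal.coe_inj, add_add_add_comm, add_halves]

/-- A curve jumping between points at distance zero is 0-Lipschitz. -/
theorem intrinsicEDist_eq_zero_of_edist_eq_zero {x y : X} (h : edist x y = 0) :
    intrinsicEDist x y = 0 := by
  have hz : ∀ s t : I, edist (if s = 0 then x else y) (if t = 0 then x else y) = 0 := by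
    intro s t
    split_ifs
    exacts [edist_self _, h, by rwa [edist_comm], edist_self _]
  have hL : LipschitzWith 0 (fun t : I => if t = 0 then x else y) := fun s t => by
    rw [hz]; exact zero_le
  simpa using (intrinsicEDist_le_curveLength hL).trans (curveLength_le_of_lipschitzWith hL)

theorem intrinsicEDist_eq_zero_iff {x y : X} : intrinsicEDist x y = 0 ↔ edist x y = 0 :=
  ⟨fun h => le_antisymm (h ▸ edist_le_intrinsicEDist x y) zero_le,
    intrinsicEDist_eq_zero_of_edist_eq_zero⟩

theorem intrinsicEDist_le_of_lipschitzWith {ρ : I → X} {c : ℝ≥0} (h : LipschitzWith c ρ)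
    (s t : I) : intrinsicEDist (ρ s) (ρ t) ≤ c * edist s t := by
  have key : ∀ s t : I, s ≤ t → intrinsicEDist (ρ s) (ρ t) ≤ c * edist s t := by
    intro s t hst
    have hst' : (s : ℝ) ≤ t := hst
    -- The affine map onto `[s, t]` already stays in `[0, 1]`; the projection only supplies the
    -- membership proof.
    let ψ : I → I := fun u => Set.projIcc (0 : ℝ) 1 zero_le_one (s + u * (t - s))
    have hψ : ∀ u v : I, edist (ψ u) (ψ v) ≤ edist s t * edist u v := by
      intro u v
      have := LipschitzWith.projIcc (zero_le_one' ℝ) (s + u * ((t : ℝ) - s)) (s + v * ((t : ℝ) - s))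
      refine this.trans_eq ?_
      rw [Subtype.edist_eq s, Subtype.edist_eq u]
      simp only [edist_dist, Real.dist_eq, ENNReal.coe_one, one_mul]
      rw [← ENNReal.ofReal_mul (abs_nonneg _), ← abs_mul, ← abs_neg]
      congr 2; ring
    have hψ0 : ψ 0 = s := by simp [ψ]
    have hψ1 : ψ 1 = t := by simp [ψ]
    have hL : LipschitzWith (c * nndist s t) (fun u => ρ (ψ u)) := by
      intro u v
      refine (h _ _).trans ((mul_le_mul_right (hψ u v) _).trans_eq ?_)
      rw [ENNReal.coe_mul, edist_nndist s, mul_assoc]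
    have := (intrinsicEDist_le_curveLength hL).trans (curveLength_le_of_lipschitzWith hL)
    rwa [hψ0, hψ1, ENNReal.coe_mul, ← edist_nndist s] at this
  rcases le_total s t with hst | hst
  · exact key s t hst
  · rw [intrinsicEDist_comm, edist_comm]
    exact key t s hst

/-- If bounded sequences have generalized limits along which the distance is lower semicontinuous,
then points at finite intrinsic distance are joined by constant speed geodesics. -/
theorem exists_geodesic_of_generalizedLimit (Bdd : (ℕ → X) → Prop)
    (hBdd : ∀ (u : ℕ → X) (x : X) (C : ℝ≥0), (∀ n, edist x (u n) ≤ C) → Bdd u)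
    (Lim : (ℕ → X) → X) (hconst : ∀ x, Lim (fun _ => x) = x)
    (hlsc : ∀ u v, Bdd u → Bdd v → ∀ c : ℝ≥0, (∀ᶠ n in atTop, edist (u n) (v n) ≤ c) →
      edist (Lim u) (Lim v) ≤ c)
    (x y : X) (hfin : intrinsicEDist x y < ∞) :
    ∃ ρ : I → X, (∃ L : ℝ≥0, ∀ s t : I, edist (ρ s) (ρ t) ≤ L * edist s t) ∧ ρ 0 = x ∧ ρ 1 = y ∧
      curveLength ρ = intrinsicEDist x y ∧
      ∀ s t : I, intrinsicEDist (ρ s) (ρ t) = edist s t * intrinsicEDist x y := by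
  obtain ⟨D, hD⟩ : ∃ D : ℝ≥0, intrinsicEDist x y = D := ⟨_, (ENNReal.coe_toNNReal hfin.ne).symm⟩
  have hJ : ∀ n : ℕ, UnitSpeedJoined x y ((D + 1 / ((n : ℝ≥0) + 1) : ℝ≥0) : ℝ) := by
    intro n
    apply unitSpeedJoined_of_intrinsicEDist_lt
    rw [hD, ENNReal.ofReal_coe_nnreal]
    exact_mod_cast lt_add_of_pos_right D (by positivity)
  choose f hf f0 f1 using hJ
  let c : ℕ → ℝ≥0 := fun n => D + 1 / ((n : ℝ≥0) + 1)
  -- Near-minimizers rescaled to `[0,1]`. The sequences `F 0` and `F 1` are constant, so `hconst`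
  -- recovers the endpoints exactly.
  let F : I → ℕ → X := fun t n => f n (c n * t)
  have hF : ∀ s t n, edist (F s n) (F t n) ≤ c n * edist s t := by
    intro s t n
    refine (hf n _ _).trans_eq ?_
    rw [Subtype.edist_eq]
    simp only [edist_dist, Real.dist_eq, ENNReal.coe_one, one_mul, ← mul_sub, abs_mul,
      NNReal.abs_eq]
    rw [ENNReal.ofReal_mul (c n).coe_nonneg, ENNReal.ofReal_coe_nnreal]
  have hF0 : ∀ n, F 0 n = x := fun n => by simpa [F] using f0 n
  have hF1 : ∀ n, F 1 n = y := fun n => by simpa [F, c] using f1 n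
  have hcD : Tendsto c atTop (𝓝 D) := by
    have := (tendsto_const_nhds (x := D)).add (tendsto_one_div_add_atTop_nhds_zero_nat (𝕜 := ℝ≥0))
    simpa [c] using this
  have hb : ∀ t, Bdd (F t) := by
    intro t
    refine hBdd _ x (D + 1) fun n => ?_
    rw [← hF0 n]
    refine (hF 0 t n).trans ?_
    have h1 : edist (0 : I) t ≤ 1 := by
      rw [Subtype.edist_eq, edist_dist, Real.dist_eq, ENNReal.ofReal_le_one]
      simpa [abs_of_nonneg t.2.1] using t.2.2
    have h2 : c n ≤ D + 1 := by
      refine add_le_add le_rfl ?_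
      rw [div_le_one (by positivity)]
      exact le_add_of_nonneg_left (by positivity)
    calc (c n : ℝ≥0∞) * edist (0 : I) t ≤ (D + 1 : ℝ≥0) * 1 :=
          mul_le_mul' (ENNReal.coe_le_coe.2 h2) h1
      _ = _ := by simp
  let ρ : I → X := fun t => Lim (F t)
  have hρ0 : ρ 0 = x := by
    have : F 0 = fun _ => x := funext hF0
    simp only [ρ, this, hconst]
  have hρ1 : ρ 1 = y := by
    have : F 1 = fun _ => y := funext hF1
    simp only [ρ, this, hconst]
  have hLip : LipschitzWith D ρ := by
    intro s t
    rw [edist_nndist s t, ← ENNReal.coe_mul]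
    refine le_of_forall_gt fun r hr => ?_
    obtain ⟨q, hq, hqr⟩ := ENNReal.lt_iff_exists_nnreal_btwn.1 hr
    refine (hlsc _ _ (hb s) (hb t) q ?_).trans_lt hqr
    have : Tendsto (fun n => c n * nndist s t) atTop (𝓝 (D * nndist s t)) :=
      hcD.mul_const _
    filter_upwards [this.eventually_lt_const (ENNReal.coe_lt_coe.1 hq)] with n hn
    refine (hF s t n).trans ?_
    rw [edist_nndist s t, ← ENNReal.coe_mul]
    exact ENNReal.coe_le_coe.2 hn.le
  have hup := intrinsicEDist_le_of_lipschitzWith hLip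
  refine ⟨ρ, ⟨D, hLip⟩, hρ0, hρ1, ?_, fun s t => ?_⟩
  · refine le_antisymm (hD ▸ curveLength_le_of_lipschitzWith hLip) ?_
    simpa only [hρ0, hρ1] using intrinsicEDist_le_curveLength hLip
  · have key : ∀ s t : I, s ≤ t → intrinsicEDist (ρ s) (ρ t) = edist s t * intrinsicEDist x y := by
      intro s t hst
      refine le_antisymm (by rw [hD, mul_comm]; exact hup s t) ?_
      -- The upper bounds over `[0,s]`, `[s,t]`, `[t,1]` add up to exactly `D`, so none of them can
      -- be strict.
      have htri : intrinsicEDist x y ≤ intrinsicEDist (ρ 0) (ρ s) + intrinsicEDist (ρ s) (ρ t) +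
          intrinsicEDist (ρ t) (ρ 1) := by
        conv_lhs => rw [← hρ0, ← hρ1]
        exact (intrinsicEDist_triangle _ (ρ t) _).trans
          (add_le_add (intrinsicEDist_triangle _ _ _) le_rfl)
      have hne : intrinsicEDist (ρ s) (ρ t) ≠ ∞ :=
        ((hup s t).trans_lt (ENNReal.mul_lt_top ENNReal.coe_lt_top (edist_lt_top _ _))).ne
      have htri' := htri.trans (add_le_add (add_le_add (hup 0 s) le_rfl) (hup t 1))
      rw [hD] at htri' ⊢
      lift intrinsicEDist (ρ s) (ρ t) to ℝ≥0 using hne with A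
      simp only [edist_nndist, ← ENNReal.coe_mul, ← ENNReal.coe_add, ENNReal.coe_le_coe,
        ← NNReal.coe_le_coe, NNReal.coe_mul, NNReal.coe_add, coe_nndist, Subtype.dist_eq,
        Real.dist_eq, Set.Icc.coe_zero, Set.Icc.coe_one] at htri' ⊢
      have hst' : (s : ℝ) ≤ t := hst
      rw [abs_of_nonpos (by linarith [s.2.1]), abs_of_nonpos (by linarith [t.2.2])] at htri'
      rw [abs_of_nonpos (by linarith)]
      linarith
    rcases le_total s t with hst | hst
    · exact key s t hst
    · rw [intrinsicEDist_comm, edist_comm]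
      exact key t s hst

end Intrinsic

/-! ### Couplings and the triangle inequality for `IGW` -/

section Gluing

open ProbabilityTheory

/-- **Gluing lemma**: two couplings with a common marginal are marginals of a joint law. -/
theorem exists_gluing {A B C : Type*} [MeasurableSpace A] [MeasurableSpace B] [MeasurableSpace C]
    [StandardBorelSpace A] [StandardBorelSpace C] [Nonempty A] [Nonempty C]
    (π : Measure (A × B)) (ρ : Measure (B × C)) [IsProbabilityMeasure π] [IsProbabilityMeasure ρ]
    (h : π.map Prod.snd = ρ.map Prod.fst) :
    ∃ γ : Measure (B × A × C), IsProbabilityMeasure γ ∧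
      γ.map (fun z => (z.2.1, z.1)) = π ∧ γ.map (fun z => (z.1, z.2.2)) = ρ := by
  set π' : Measure (B × A) := π.map Prod.swap with hπ'
  have : IsProbabilityMeasure π' := Measure.isProbabilityMeasure_map measurable_swap.aemeasurable
  have hswap : π'.map Prod.swap = π := by
    rw [hπ', Measure.map_map measurable_swap measurable_swap]
    simp
  have hfst : π'.fst = ρ.fst := by
    rw [Measure.fst, Measure.fst, ← h, hπ', Measure.map_map measurable_fst measurable_swap]
    rfl
  -- Given the common coordinate, the other two are taken conditionally independent.
  refine ⟨ρ.fst ⊗ₘ (π'.condKernel ×ₖ ρ.condKernel), inferInstance, ?_, ?_⟩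
  · have e : (ρ.fst ⊗ₘ (π'.condKernel ×ₖ ρ.condKernel)).map (Prod.map id Prod.fst) = π' := by
      rw [← Measure.compProd_map measurable_fst, ← Kernel.fst_eq, Kernel.fst_prod, ← hfst]
      exact π'.disintegrate π'.condKernel
    have := congrArg (Measure.map Prod.swap) e
    rw [hswap, Measure.map_map measurable_swap (by fun_prop)] at this
    exact this
  · have e : (ρ.fst ⊗ₘ (π'.condKernel ×ₖ ρ.condKernel)).map (Prod.map id Prod.snd) = ρ := by
      rw [← Measure.compProd_map measurable_snd, ← Kernel.snd_eq, Kernel.snd_prod]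
      exact ρ.disintegrate ρ.condKernel
    exact e

end Gluing

/-! ### Gram kernels and `IGW` in terms of random vectors -/

section Distortion

variable {d : ℕ} {Ω Ω' : Type*} [MeasurableSpace Ω] [MeasurableSpace Ω']

/-- The `L²` distance between the Gram kernels of two random vectors. -/
noncomputable def gramDist (P : Measure Ω) (X Y : Ω → EuclideanSpace ℝ (Fin d)) : ℝ≥0∞ :=
  eLpNorm (fun z : Ω × Ω => inner ℝ (X z.1) (X z.2) - inner ℝ (Y z.1) (Y z.2)) 2 (P.prod P)

theorem measurable_gram {X : Ω → EuclideanSpace ℝ (Fin d)} (hX : Measurable X) :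
    Measurable fun z : Ω × Ω => inner ℝ (X z.1) (X z.2) :=
  (hX.comp measurable_fst).inner (hX.comp measurable_snd)

theorem gramDist_self (P : Measure Ω) (X : Ω → EuclideanSpace ℝ (Fin d)) : gramDist P X X = 0 := by
  simp [gramDist]

theorem gramDist_comm (P : Measure Ω) (X Y : Ω → EuclideanSpace ℝ (Fin d)) :
    gramDist P X Y = gramDist P Y X := by
  rw [gramDist, ← eLpNorm_neg]
  congr 1; ext z; simp

theorem gramDist_triangle (P : Measure Ω) {X Y Z : Ω → EuclideanSpace ℝ (Fin d)}
    (hX : Measurable X) (hY : Measurable Y) (hZ : Measurable Z) :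
    gramDist P X Z ≤ gramDist P X Y + gramDist P Y Z := by
  refine le_trans (le_of_eq ?_) (eLpNorm_add_le
    ((measurable_gram hX).sub (measurable_gram hY)).aestronglyMeasurable
    ((measurable_gram hY).sub (measurable_gram hZ)).aestronglyMeasurable one_le_two)
  rw [gramDist]
  congr 1; ext z; simp

theorem gramDist_map {P : Measure Ω} [IsProbabilityMeasure P] {f : Ω → Ω'} (hf : Measurable f)
    {X Y : Ω' → EuclideanSpace ℝ (Fin d)} (hX : Measurable X) (hY : Measurable Y) :
    gramDist (P.map f) X Y = gramDist P (X ∘ f) (Y ∘ f) := by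
  have := Measure.isProbabilityMeasure_map (μ := P) hf.aemeasurable
  rw [gramDist, Measure.map_prod_map _ _ hf hf]
  exact eLpNorm_map_measure ((measurable_gram hX).sub (measurable_gram hY)).aestronglyMeasurable
    (by fun_prop)

theorem igwCost_rpow_eq_gramDist
    (π : ProbabilityMeasure (EuclideanSpace ℝ (Fin d) × EuclideanSpace ℝ (Fin d))) :
    igwCost π ^ (1 / 2 : ℝ) = gramDist π.toMeasure Prod.fst Prod.snd := by
  rw [gramDist, eLpNorm_eq_lintegral_rpow_enorm_toReal (by simp) (by simp), igwCost]
  congr 1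
  refine lintegral_congr fun z => ?_
  rw [← Real.enorm_eq_ofReal (by positivity)]
  simp

theorem IGW_eq_iInf (μ ν : P2 d) :
    IGW μ ν = ⨅ π ∈ couplings μ.1 ν.1, gramDist π.toMeasure Prod.fst Prod.snd := by
  have h : (0 : ℝ) < 1 / 2 := by norm_num
  simp_rw [← igwCost_rpow_eq_gramDist]
  rw [IGW, ← ENNReal.orderIsoRpow_apply _ h]
  simp_rw [OrderIso.map_iInf, ENNReal.orderIsoRpow_apply]

theorem IGW_le_gramDist {μ ν : P2 d} {P : Measure Ω} [IsProbabilityMeasure P]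
    {X Y : Ω → EuclideanSpace ℝ (Fin d)} (hX : Measurable X) (hY : Measurable Y)
    (hμ : P.map X = (μ.1 : Measure _)) (hν : P.map Y = (ν.1 : Measure _)) :
    IGW μ ν ≤ gramDist P X Y := by
  have hXY : Measurable fun ω => (X ω, Y ω) := hX.prodMk hY
  let π : ProbabilityMeasure (EuclideanSpace ℝ (Fin d) × EuclideanSpace ℝ (Fin d)) :=
    ⟨P.map fun ω => (X ω, Y ω), Measure.isProbabilityMeasure_map hXY.aemeasurable⟩
  rw [IGW_eq_iInf]
  refine iInf₂_le_of_le π ⟨?_, ?_⟩ ?_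
  · change (P.map _).map _ = _
    rw [Measure.map_map measurable_fst hXY, ← hμ]; rfl
  · change (P.map _).map _ = _
    rw [Measure.map_map measurable_snd hXY, ← hν]; rfl
  · change gramDist (P.map _) _ _ ≤ _
    rw [gramDist_map hXY measurable_fst measurable_snd]
    rfl

theorem exists_coupling_gramDist_lt {μ ν : P2 d} {c : ℝ≥0∞} (h : IGW μ ν < c) :
    ∃ π ∈ couplings μ.1 ν.1, gramDist π.toMeasure Prod.fst Prod.snd < c := by
  rw [IGW_eq_iInf] at h
  simpa only [iInf_lt_iff, exists_prop] using h

theorem IGW_self (μ : P2 d) : IGW μ μ = 0 :=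
  le_antisymm ((IGW_le_gramDist (P := (μ.1 : Measure _)) measurable_id measurable_id
    Measure.map_id Measure.map_id).trans_eq (gramDist_self _ _)) zero_le

theorem IGW_comm (μ ν : P2 d) : IGW μ ν = IGW ν μ := by
  have key : ∀ μ ν : P2 d, IGW μ ν ≤ IGW ν μ := by
    intro μ ν
    refine le_of_forall_gt fun c hc => ?_
    obtain ⟨π, hπ, h⟩ := exists_coupling_gramDist_lt hc
    refine (IGW_le_gramDist measurable_snd measurable_fst hπ.2 hπ.1).trans_lt ?_
    rwa [gramDist_comm]
  exact le_antisymm (key _ _) (key _ _)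

theorem IGW_triangle (μ ν ξ : P2 d) : IGW μ ξ ≤ IGW μ ν + IGW ν ξ := by
  refine ENNReal.le_of_forall_pos_le_add fun ε hε hfin => ?_
  obtain ⟨h1, h2⟩ := ENNReal.add_lt_top.1 hfin
  have hε2 : ((ε / 2 : ℝ≥0) : ℝ≥0∞) ≠ 0 := by simpa using hε.ne'
  obtain ⟨π, hπ, k1⟩ := exists_coupling_gramDist_lt (ENNReal.lt_add_right h1.ne hε2)
  obtain ⟨ρ, hρ, k2⟩ := exists_coupling_gramDist_lt (ENNReal.lt_add_right h2.ne hε2)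
  obtain ⟨γ, hγ, e1, e2⟩ := exists_gluing π.toMeasure ρ.toMeasure (hπ.2.trans hρ.1.symm)
  have m1 : Measurable fun z : EuclideanSpace ℝ (Fin d) × EuclideanSpace ℝ (Fin d) ×
    EuclideanSpace ℝ (Fin d) => (z.2.1, z.1) := by fun_prop
  have m2 : Measurable fun z : EuclideanSpace ℝ (Fin d) × EuclideanSpace ℝ (Fin d) ×
    EuclideanSpace ℝ (Fin d) => (z.1, z.2.2) := by fun_prop
  rw [← e1, gramDist_map m1 measurable_fst measurable_snd] at k1
  rw [← e2, gramDist_map m2 measurable_fst measurable_snd] at k2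
  have hle : IGW μ ξ ≤ gramDist γ (fun z => z.2.1) (fun z => z.2.2) := by
    refine IGW_le_gramDist (by fun_prop) (by fun_prop) ?_ ?_
    · rw [← hπ.1, ← e1, Measure.map_map measurable_fst m1]; rfl
    · rw [← hρ.2, ← e2, Measure.map_map measurable_snd m2]; rfl
  calc IGW μ ξ ≤ _ := hle
    _ ≤ gramDist γ (fun z => z.2.1) (fun z => z.1) + gramDist γ (fun z => z.1) (fun z => z.2.2) :=
        gramDist_triangle γ (by fun_prop) (by fun_prop) (by fun_prop)
    _ ≤ (IGW μ ν + (ε / 2 : ℝ≥0)) + (IGW ν ξ + (ε / 2 : ℝ≥0)) := add_le_add k1.le k2.le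
    _ = IGW μ ν + IGW ν ξ + ε := by
        rw [add_add_add_comm, ← ENNReal.coe_add, add_halves]

/-- The pseudo-extended-metric structure on `P2 d` whose distance is `IGW`. -/
@[reducible]
noncomputable def igwPseudoEMetricSpace (d : ℕ) : PseudoEMetricSpace (P2 d) where
  edist := IGW
  edist_self := IGW_self
  edist_comm := IGW_comm
  edist_triangle := IGW_triangle

theorem dIGW_triangle (μ ν ξ : P2 d) : dIGW μ ξ ≤ dIGW μ ν + dIGW ν ξ :=
  let := igwPseudoEMetricSpace d
  intrinsicEDist_triangle μ ν ξ

theorem dIGW_comm (μ ν : P2 d) : dIGW μ ν = dIGW ν μ :=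
  let := igwPseudoEMetricSpace d
  intrinsicEDist_comm μ ν

theorem dIGW_eq_zero_iff (μ ν : P2 d) : dIGW μ ν = 0 ↔ IGW μ ν = 0 :=
  let := igwPseudoEMetricSpace d
  intrinsicEDist_eq_zero_iff (x := μ) (y := ν)

theorem dIGW_le_of_lipschitz {ρ : I → P2 d} {c : ℝ≥0}
    (h : ∀ s t, IGW (ρ s) (ρ t) ≤ c * edist s t) : dIGW (ρ 0) (ρ 1) ≤ c := by
  let := igwPseudoEMetricSpace d
  have hL : LipschitzWith c ρ := h
  exact (intrinsicEDist_le_curveLength hL).trans (curveLength_le_of_lipschitzWith hL)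

end Distortion

/-! ### Upper bounds for the intrinsic distance -/

section UpperBounds

variable {d : ℕ} {Ω : Type*} [MeasurableSpace Ω]

/-- Pointwise Cauchy–Schwarz, after which Tonelli factors the squared norm. -/
theorem eLpNorm_inner_prod_le (P : Measure Ω) [SFinite P] {A B : Ω → EuclideanSpace ℝ (Fin d)}
    (hA : Measurable A) (hB : Measurable B) :
    eLpNorm (fun z : Ω × Ω => (inner ℝ (A z.1) (B z.2) : ℝ)) 2 (P.prod P) ≤
      eLpNorm A 2 P * eLpNorm B 2 P := by
  simp only [eLpNorm_eq_lintegral_rpow_enorm_toReal (p := 2) two_ne_zero ENNReal.ofNat_ne_top]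
  rw [← ENNReal.mul_rpow_of_nonneg _ _ (by positivity),
    ← lintegral_prod_mul (by fun_prop) (by fun_prop)]
  gcongr with z
  rw [← ENNReal.mul_rpow_of_nonneg _ _ (by positivity)]
  gcongr
  simp only [← ofReal_norm]
  rw [← ENNReal.ofReal_mul (norm_nonneg _)]
  exact ENNReal.ofReal_le_ofReal (norm_inner_le_norm _ _)

/-- This estimate turns `L²`-Lipschitz curves of random vectors with bounded norms into
`IGW`-Lipschitz curves of laws. -/
theorem gramDist_le (P : Measure Ω) [SFinite P] {X Y : Ω → EuclideanSpace ℝ (Fin d)}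
    (hX : Measurable X) (hY : Measurable Y) :
    gramDist P X Y ≤ eLpNorm (X - Y) 2 P * (eLpNorm X 2 P + eLpNorm Y 2 P) := by
  have hXY := hX.sub hY
  have e : (fun z : Ω × Ω => (inner ℝ (X z.1) (X z.2) - inner ℝ (Y z.1) (Y z.2) : ℝ)) =
      (fun z : Ω × Ω => (inner ℝ ((X - Y) z.1) (X z.2) : ℝ)) +
        fun z : Ω × Ω => (inner ℝ (Y z.1) ((X - Y) z.2) : ℝ) := by
    ext z
    simp only [Pi.add_apply, Pi.sub_apply, inner_sub_left, inner_sub_right]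
    ring
  rw [gramDist, e]
  refine (eLpNorm_add_le
    ((hXY.comp measurable_fst).inner (hX.comp measurable_snd)).aestronglyMeasurable
    ((hY.comp measurable_fst).inner (hXY.comp measurable_snd)).aestronglyMeasurable
    one_le_two).trans ?_
  rw [mul_add, mul_comm (eLpNorm (X - Y) 2 P) (eLpNorm Y 2 P)]
  exact add_le_add (eLpNorm_inner_prod_le P hXY hX) (eLpNorm_inner_prod_le P hY hXY)

theorem lintegral_enorm_sq_eq {E : Type*} [NormedAddCommGroup E] (P : Measure Ω) (X : Ω → E) :
    ∫⁻ ω, ‖X ω‖ₑ ^ 2 ∂P = eLpNorm X 2 P ^ 2 := by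
  rw [eLpNorm_eq_lintegral_rpow_enorm_toReal two_ne_zero ENNReal.ofNat_ne_top,
    ← ENNReal.rpow_natCast _ 2, ← ENNReal.rpow_mul]
  simp

theorem lintegral_map_enorm_sq (P : Measure Ω) {X : Ω → EuclideanSpace ℝ (Fin d)}
    (hX : Measurable X) : ∫⁻ x, ‖x‖ₑ ^ 2 ∂(P.map X) = eLpNorm X 2 P ^ 2 := by
  rw [lintegral_map (by fun_prop) hX, lintegral_enorm_sq_eq]

theorem eLpNorm_lt_top_of_map_eq {μ : P2 d} {P : Measure Ω} {X : Ω → EuclideanSpace ℝ (Fin d)}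
    (hX : Measurable X) (h : P.map X = (μ.1 : Measure _)) : eLpNorm X 2 P < ∞ := by
  have := μ.2
  rw [← h, lintegral_map_enorm_sq P hX] at this
  exact (ENNReal.pow_lt_top_iff.1 this).resolve_right (by norm_num)

/-- The law of a square integrable random vector. -/
noncomputable def lawP2 (P : Measure Ω) [IsProbabilityMeasure P] (X : Ω → EuclideanSpace ℝ (Fin d))
    (hX : Measurable X) (h : eLpNorm X 2 P < ∞) : P2 d :=
  ⟨⟨P.map X, Measure.isProbabilityMeasure_map hX.aemeasurable⟩, by
    change ∫⁻ x, ‖x‖ₑ ^ 2 ∂(P.map X) < ∞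
    rw [lintegral_map_enorm_sq P hX]
    exact ENNReal.pow_lt_top h⟩

theorem eq_lawP2 {μ : P2 d} {P : Measure Ω} [IsProbabilityMeasure P]
    {X : Ω → EuclideanSpace ℝ (Fin d)} (hX : Measurable X) (h : eLpNorm X 2 P < ∞)
    (hμ : P.map X = (μ.1 : Measure _)) : lawP2 P X hX h = μ :=
  Subtype.ext (Subtype.ext hμ)

theorem IGW_lawP2_le (P : Measure Ω) [IsProbabilityMeasure P]
    {X Y : Ω → EuclideanSpace ℝ (Fin d)} (hX : Measurable X) (hX' : eLpNorm X 2 P < ∞)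
    (hY : Measurable Y) (hY' : eLpNorm Y 2 P < ∞) :
    IGW (lawP2 P X hX hX') (lawP2 P Y hY hY') ≤ gramDist P X Y :=
  IGW_le_gramDist hX hY rfl rfl

/-- Comparison of the intrinsic distance with the `L²` distance, by linear interpolation. -/
theorem dIGW_le_eLpNorm {μ ν : P2 d} {P : Measure Ω} [IsProbabilityMeasure P]
    {X Y : Ω → EuclideanSpace ℝ (Fin d)} (hX : Measurable X) (hY : Measurable Y)
    (hμ : P.map X = (μ.1 : Measure _)) (hν : P.map Y = (ν.1 : Measure _)) :
    dIGW μ ν ≤ eLpNorm (Y - X) 2 P * (2 * (eLpNorm X 2 P + eLpNorm (Y - X) 2 P)) := by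
  have hX' := eLpNorm_lt_top_of_map_eq hX hμ
  have hY' := eLpNorm_lt_top_of_map_eq hY hν
  set Z := Y - X with hZdef
  have hZ : Measurable Z := hY.sub hX
  have hZ' : eLpNorm Z 2 P < ∞ := (eLpNorm_sub_le hY.aestronglyMeasurable
    hX.aestronglyMeasurable one_le_two).trans_lt (ENNReal.add_lt_top.2 ⟨hY', hX'⟩)
  have hm : ∀ t : I, Measurable (X + (t : ℝ) • Z) := fun t => hX.add (hZ.const_smul (t : ℝ))
  have hle : ∀ t : I, eLpNorm (X + (t : ℝ) • Z) 2 P ≤ eLpNorm X 2 P + eLpNorm Z 2 P := by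
    intro t
    refine (eLpNorm_add_le hX.aestronglyMeasurable
      (hZ.const_smul (t : ℝ)).aestronglyMeasurable one_le_two).trans (add_le_add le_rfl ?_)
    rw [eLpNorm_const_smul]
    refine mul_le_of_le_one_left' ?_
    rw [Real.enorm_eq_ofReal t.2.1, ENNReal.ofReal_le_one]
    exact t.2.2
  have hlt : ∀ t : I, eLpNorm (X + (t : ℝ) • Z) 2 P < ∞ := fun t =>
    (hle t).trans_lt (ENNReal.add_lt_top.2 ⟨hX', hZ'⟩)
  set c : ℝ≥0∞ := eLpNorm Z 2 P * (2 * (eLpNorm X 2 P + eLpNorm Z 2 P)) with hc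
  have hctop : c ≠ ∞ := by finiteness
  have key : ∀ s t : I, IGW (lawP2 P _ (hm s) (hlt s)) (lawP2 P _ (hm t) (hlt t)) ≤
      c.toNNReal * edist s t := by
    intro s t
    rw [ENNReal.coe_toNNReal hctop]
    refine (IGW_lawP2_le P _ _ _ _).trans ((gramDist_le P (hm s) (hm t)).trans ?_)
    have e : X + (s : ℝ) • Z - (X + (t : ℝ) • Z) = ((s : ℝ) - t) • Z := by
      rw [sub_smul]; abel
    have e2 : ‖(s : ℝ) - t‖ₑ = edist s t := by
      rw [Subtype.edist_eq, edist_eq_enorm_sub]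
    rw [e, eLpNorm_const_smul, e2, mul_comm c, hc, mul_assoc, two_mul]
    gcongr
    exacts [hle s, hle t]
  have h := dIGW_le_of_lipschitz key
  rw [ENNReal.coe_toNNReal hctop] at h
  convert h using 2
  · exact (eq_lawP2 _ _ (by simpa using hμ)).symm
  · exact (eq_lawP2 _ _ (by simpa [hZdef] using hν)).symm

theorem dIGW_lt_top (μ ν : P2 d) : dIGW μ ν < ∞ := by
  have h1 : (μ.1.toMeasure.prod ν.1.toMeasure).map Prod.fst = (μ.1 : Measure _) := by
    simp [Measure.map_fst_prod]
  have h2 : (μ.1.toMeasure.prod ν.1.toMeasure).map Prod.snd = (ν.1 : Measure _) := by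
    simp [Measure.map_snd_prod]
  refine (dIGW_le_eLpNorm measurable_fst measurable_snd h1 h2).trans_lt ?_
  have k1 := eLpNorm_lt_top_of_map_eq measurable_fst h1
  have k2 := eLpNorm_lt_top_of_map_eq measurable_snd h2
  have k3 := (eLpNorm_sub_le measurable_snd.aestronglyMeasurable
    measurable_fst.aestronglyMeasurable one_le_two).trans_lt (ENNReal.add_lt_top.2 ⟨k2, k1⟩)
  finiteness

open Matrix MatrixOrder Matrix.Norms.L2Operator in
/-- Convex combinations of Gram kernels of linear maps are Gram kernels of linear maps. -/
theorem exists_gram_interpolation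
    (T : EuclideanSpace ℝ (Fin d) →L[ℝ] EuclideanSpace ℝ (Fin d)) (t : I) :
    ∃ B : EuclideanSpace ℝ (Fin d) →L[ℝ] EuclideanSpace ℝ (Fin d), ∀ x y,
      (inner ℝ (B x) (B y) : ℝ) = (1 - t) * inner ℝ x y + t * inner ℝ (T x) (T y) := by
  let e := Matrix.toEuclideanCLM (n := Fin d) (𝕜 := ℝ)
  have hgram : ∀ (M : Matrix (Fin d) (Fin d) ℝ) (x y),
      (inner ℝ (e M x) (e M y) : ℝ) = inner ℝ x (e (star M * M) y) := by
    intro M x y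
    rw [map_mul, map_star, ContinuousLinearMap.star_eq_adjoint, mul_apply_eq_comp,
      ContinuousLinearMap.adjoint_inner_right]
  obtain ⟨M, rfl⟩ : ∃ M, e M = T := EquivLike.surjective e T
  -- The Gram kernel of `e B` is the bilinear form of `star B * B`, so it suffices to factor a
  -- positive semidefinite matrix.
  have hQ : ((1 - t : ℝ) • (1 : Matrix (Fin d) (Fin d) ℝ) + (t : ℝ) • (Mᴴ * M)).PosSemidef :=
    (Matrix.PosSemidef.one.smul (sub_nonneg.2 t.2.2)).add
      ((Matrix.posSemidef_conjTranspose_mul_self M).smul t.2.1)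
  obtain ⟨B, hB⟩ := CStarAlgebra.nonneg_iff_eq_star_mul_self.mp (Matrix.nonneg_iff_posSemidef.2 hQ)
  refine ⟨e B, fun x y => ?_⟩
  rw [hgram, hgram, ← hB, ← Matrix.star_eq_conjTranspose]
  simp [inner_add_right, inner_smul_right]

/-- Comparison of the intrinsic distance with the Gram distance, for linear images. -/
theorem dIGW_le_gramDist_of_linear {μ ν : P2 d}
    (T : EuclideanSpace ℝ (Fin d) →L[ℝ] EuclideanSpace ℝ (Fin d))
    (hν : (μ.1 : Measure _).map T = (ν.1 : Measure _)) :
    dIGW μ ν ≤ gramDist μ.1.toMeasure id T := by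
  have hB : ∃ B : I → (EuclideanSpace ℝ (Fin d) →L[ℝ] EuclideanSpace ℝ (Fin d)),
      B 0 = ContinuousLinearMap.id ℝ _ ∧ B 1 = T ∧ ∀ t x y,
      (inner ℝ (B t x) (B t y) : ℝ) = (1 - t) * inner ℝ x y + t * inner ℝ (T x) (T y) := by
    choose B hB using exists_gram_interpolation T
    -- A factor is determined only up to a left orthogonal matrix, so the endpoint maps are
    -- prescribed.
    refine ⟨fun t => if t = 0 then ContinuousLinearMap.id ℝ _ else if t = 1 then T else B t,
      by simp, by simp, fun t x y => ?_⟩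
    dsimp only
    split_ifs with h0 h1
    · simp [h0]
    · simp [h1]
    · exact hB t x y
  obtain ⟨B, hB0, hB1, hB⟩ := hB
  have hm : ∀ t, Measurable (B t) := fun t => (B t).continuous.measurable
  have hlt : ∀ t, eLpNorm (B t) 2 μ.1.toMeasure < ∞ := fun t => by
    have h1 : eLpNorm (fun x : EuclideanSpace ℝ (Fin d) => x) 2 μ.1.toMeasure < ∞ :=
      eLpNorm_lt_top_of_map_eq measurable_id Measure.map_id
    refine (eLpNorm_le_mul_eLpNorm_of_ae_le_mul (c := ‖B t‖)
      (Eventually.of_forall fun x => (B t).le_opNorm x) 2).trans_lt ?_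
    finiteness
  set c := gramDist μ.1.toMeasure id T with hc
  have hgd : ∀ s t : I, gramDist μ.1.toMeasure (B s) (B t) = edist s t * c := by
    intro s t
    have e : (fun z : EuclideanSpace ℝ (Fin d) × EuclideanSpace ℝ (Fin d) =>
        (inner ℝ (B s z.1) (B s z.2) - inner ℝ (B t z.1) (B t z.2) : ℝ)) =
        ((t : ℝ) - s) • fun z : EuclideanSpace ℝ (Fin d) × EuclideanSpace ℝ (Fin d) =>
          (inner ℝ (id z.1) (id z.2) - inner ℝ (T z.1) (T z.2) : ℝ) := by
      ext z
      simp only [hB, Pi.smul_apply, smul_eq_mul, id]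
      ring
    rw [gramDist, e, eLpNorm_const_smul, edist_comm, Subtype.edist_eq, edist_eq_enorm_sub, hc,
      gramDist]
  rcases eq_or_ne c ∞ with htop | htop
  · rw [htop]; exact le_top
  have key : ∀ s t : I, IGW (lawP2 μ.1.toMeasure _ (hm s) (hlt s))
      (lawP2 μ.1.toMeasure _ (hm t) (hlt t)) ≤ c.toNNReal * edist s t := by
    intro s t
    rw [ENNReal.coe_toNNReal htop, mul_comm, ← hgd]
    exact IGW_lawP2_le _ _ _ _ _
  have h := dIGW_le_of_lipschitz key
  rw [ENNReal.coe_toNNReal htop] at h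
  convert h using 2
  · refine (eq_lawP2 _ _ ?_).symm
    rw [hB0]
    exact Measure.map_id
  · exact (eq_lawP2 _ _ (by rwa [hB1])).symm

end UpperBounds

/-! ### Narrow limits and existence of geodesics -/

section NarrowLimits

variable {d : ℕ}

/-- Truncating at `k` gives bounded continuous test functions; monotone convergence then removes the
truncation. -/
theorem lintegral_le_of_tendsto {E ι : Type*} [MeasurableSpace E] [TopologicalSpace E]
    [OpensMeasurableSpace E] {F : Filter ι} [F.NeBot] {μ : ι → ProbabilityMeasure E}
    {ν : ProbabilityMeasure E} (h : Tendsto μ F (𝓝 ν)) {f : E → ℝ≥0} (hf : Continuous f)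
    {C : ℝ≥0∞} (hC : ∀ᶠ i in F, ∫⁻ x, f x ∂(μ i : Measure E) ≤ C) :
    ∫⁻ x, f x ∂(ν : Measure E) ≤ C := by
  have hk : ∀ k : ℕ, ∫⁻ x, (min (f x) k : ℝ≥0) ∂(ν : Measure E) ≤ C := by
    intro k
    let g : BoundedContinuousFunction E ℝ≥0 := BoundedContinuousFunction.mkOfBound
      ⟨fun x => min (f x) k, hf.min continuous_const⟩ k fun x y => by
        rw [NNReal.dist_eq]
        refine abs_sub_le_of_nonneg_of_le (NNReal.coe_nonneg _) ?_ (NNReal.coe_nonneg _) ?_ <;>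
        exact_mod_cast min_le_right _ _
    refine le_of_tendsto (ProbabilityMeasure.tendsto_iff_forall_lintegral_tendsto.1 h g) ?_
    filter_upwards [hC] with i hi
    refine le_trans (lintegral_mono fun x => ?_) hi
    exact ENNReal.coe_le_coe.2 (min_le_left _ _)
  have hsup : ∀ x, (f x : ℝ≥0∞) = ⨆ k : ℕ, ((min (f x) k : ℝ≥0) : ℝ≥0∞) := by
    intro x
    obtain ⟨k, hk⟩ := exists_nat_ge (f x)
    refine le_antisymm (le_iSup_of_le k (by rw [min_eq_left hk])) (iSup_le fun k => ?_)
    exact ENNReal.coe_le_coe.2 (min_le_left _ _)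
  simp_rw [hsup]
  rw [lintegral_iSup]
  · exact iSup_le hk
  · exact fun k => (hf.min continuous_const).measurable.coe_nnreal_ennreal
  · intro a b hab x
    exact ENNReal.coe_le_coe.2 (min_le_min le_rfl (by exact_mod_cast hab))

theorem isTightMeasureSet_of_lintegral_enorm_sq_le
    (S : Set (Measure (EuclideanSpace ℝ (Fin d)))) (K : ℝ≥0)
    (h : ∀ μ ∈ S, ∫⁻ x, ‖x‖ₑ ^ 2 ∂μ ≤ K) : IsTightMeasureSet S := by
  refine isTightMeasureSet_of_tendsto_measure_norm_gt ?_
  have hlim : Tendsto (fun r : ℝ => (K : ℝ≥0∞) / ENNReal.ofReal r ^ 2) atTop (𝓝 0) := by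
    rw [← ENNReal.div_top (a := (K : ℝ≥0∞))]
    refine ENNReal.Tendsto.const_div ?_ (Or.inr ENNReal.coe_ne_top)
    have := ((ENNReal.continuous_pow 2).tendsto ∞).comp ENNReal.tendsto_ofReal_atTop
    rwa [ENNReal.top_pow two_ne_zero] at this
  refine tendsto_of_tendsto_of_tendsto_of_le_of_le' tendsto_const_nhds hlim
    (Eventually.of_forall fun _ => zero_le) ?_
  filter_upwards [eventually_gt_atTop 0] with r hr
  refine iSup₂_le fun μ hμ => ?_
  have hr' : ENNReal.ofReal r ^ 2 ≠ 0 := pow_ne_zero _ (ENNReal.ofReal_pos.2 hr).ne'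
  calc μ {x | r < ‖x‖} ≤ μ {x | ENNReal.ofReal r ^ 2 ≤ ‖x‖ₑ ^ 2} := by
        refine measure_mono fun x hx => ?_
        have : ENNReal.ofReal r ≤ ‖x‖ₑ := by
          rw [← ofReal_norm]; exact ENNReal.ofReal_le_ofReal (le_of_lt hx)
        exact pow_le_pow_left₀ zero_le this 2
    _ ≤ (∫⁻ x, ‖x‖ₑ ^ 2 ∂μ) / ENNReal.ofReal r ^ 2 :=
        meas_ge_le_lintegral_div (by fun_prop) hr' (by finiteness)
    _ ≤ K / ENNReal.ofReal r ^ 2 := ENNReal.div_le_div_right (h μ hμ) _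

/-- Prokhorov's theorem with an ultrafilter instead of subsequences, so that one choice serves
uncountably many times. -/
theorem exists_tendsto_of_tight {E ι : Type*} [MeasurableSpace E] [TopologicalSpace E]
    [T2Space E] [BorelSpace E] (F : Ultrafilter ι) (μ : ι → ProbabilityMeasure E)
    (h : IsTightMeasureSet (Set.range fun i => (μ i : Measure E))) :
    ∃ ν, Tendsto μ F (𝓝 ν) := by
  have hc : IsCompact (closure (Set.range μ)) := by
    apply isCompact_closure_of_isTightMeasureSet
    convert h
    ext m; simp
  obtain ⟨ν, -, hν⟩ := hc.ultrafilter_le_nhds (F.map μ) (by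
    rw [Ultrafilter.coe_map, le_principal_iff]
    exact mem_map.2 (univ_mem' fun i => subset_closure ⟨i, rfl⟩))
  exact ⟨ν, hν⟩

theorem exists_tendsto_of_moment_le (F : Ultrafilter ℕ) (u : ℕ → P2 d) (K : ℝ≥0)
    (h : ∀ n, ∫⁻ x, ‖x‖ₑ ^ 2 ∂(u n).1.toMeasure ≤ K) :
    ∃ ν : P2 d, Tendsto (fun n => (u n).1) F (𝓝 ν.1) := by
  obtain ⟨ν, hν⟩ := exists_tendsto_of_tight F (fun n => (u n).1)
    (isTightMeasureSet_of_lintegral_enorm_sq_le _ K (by rintro _ ⟨n, rfl⟩; exact h n))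
  have := lintegral_le_of_tendsto hν (f := fun x => ‖x‖₊ ^ 2) (by fun_prop) (C := K)
    (Eventually.of_forall fun n => by simpa [enorm] using h n)
  refine ⟨⟨ν, lt_of_le_of_lt ?_ (ENNReal.coe_lt_top (r := K))⟩, hν⟩
  simpa [enorm] using this

theorem igwCost_le_of_tendsto {ι : Type*} {F : Filter ι} [F.NeBot]
    {π : ι → ProbabilityMeasure (EuclideanSpace ℝ (Fin d) × EuclideanSpace ℝ (Fin d))}
    {ρ : ProbabilityMeasure (EuclideanSpace ℝ (Fin d) × EuclideanSpace ℝ (Fin d))}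
    (h : Tendsto π F (𝓝 ρ)) {C : ℝ≥0∞} (hC : ∀ᶠ i in F, igwCost (π i) ≤ C) : igwCost ρ ≤ C := by
  have h2 : Tendsto (fun i => (π i).prod (π i)) F (𝓝 (ρ.prod ρ)) :=
    (ProbabilityMeasure.continuous_prod.tendsto (ρ, ρ)).comp (h.prodMk_nhds h)
  exact lintegral_le_of_tendsto h2 (f := fun z => Real.toNNReal
    (|inner ℝ z.1.1 z.2.1 - inner ℝ z.1.2 z.2.2| ^ 2)) (by fun_prop) hC

theorem IGW_lt_top (μ ν : P2 d) : IGW μ ν < ∞ := by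
  let := igwPseudoEMetricSpace d
  exact (edist_le_intrinsicEDist μ ν).trans_lt (dIGW_lt_top μ ν)

/-- Near-optimal couplings are tight because their marginals are. An ultrafilter limit couples the
limit measures, and the cost is lower semicontinuous. -/
theorem IGW_le_of_tendsto {F : Ultrafilter ℕ} {u v : ℕ → P2 d} {μ ν : P2 d} {K K' : ℝ≥0}
    (hu : ∀ n, ∫⁻ x, ‖x‖ₑ ^ 2 ∂(u n).1.toMeasure ≤ K)
    (hv : ∀ n, ∫⁻ x, ‖x‖ₑ ^ 2 ∂(v n).1.toMeasure ≤ K')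
    (hμ : Tendsto (fun n => (u n).1) F (𝓝 μ.1)) (hν : Tendsto (fun n => (v n).1) F (𝓝 ν.1))
    {c : ℝ≥0∞} (hc : ∀ᶠ n in F, IGW (u n) (v n) ≤ c) : IGW μ ν ≤ c := by
  refine le_of_forall_gt_imp_ge_of_dense fun c' hc' => ?_
  have hex : ∀ n, ∃ π ∈ couplings (u n).1 (v n).1,
      IGW (u n) (v n) ≤ c → gramDist π.toMeasure Prod.fst Prod.snd < c' := by
    intro n
    by_cases hn : IGW (u n) (v n) ≤ c
    · obtain ⟨π, hπ, h⟩ := exists_coupling_gramDist_lt (hn.trans_lt hc')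
      exact ⟨π, hπ, fun _ => h⟩
    · obtain ⟨π, hπ, -⟩ := exists_coupling_gramDist_lt (IGW_lt_top (u n) (v n))
      exact ⟨π, hπ, fun h => absurd h hn⟩
  choose π hπ hlt using hex
  obtain ⟨ρ, hρ⟩ := exists_tendsto_of_tight F π (by
    refine IsTightMeasureSet.prodMk ?_ ?_
    · refine isTightMeasureSet_of_lintegral_enorm_sq_le _ K ?_
      rintro _ ⟨_, ⟨n, rfl⟩, rfl⟩
      rw [Measure.fst, (hπ n).1]
      exact hu n
    · refine isTightMeasureSet_of_lintegral_enorm_sq_le _ K' ?_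
      rintro _ ⟨_, ⟨n, rfl⟩, rfl⟩
      rw [Measure.snd, (hπ n).2]
      exact hv n)
  have hmem : ρ ∈ couplings μ.1 ν.1 := by
    constructor
    · have h1 := ((ProbabilityMeasure.continuous_map (continuous_fst
        (X := EuclideanSpace ℝ (Fin d)) (Y := EuclideanSpace ℝ (Fin d)))).tendsto ρ).comp hρ
      have h2 := tendsto_nhds_unique h1 (hμ.congr fun n => Subtype.ext (hπ n).1.symm)
      exact congrArg Subtype.val h2
    · have h1 := ((ProbabilityMeasure.continuous_map (continuous_snd
        (X := EuclideanSpace ℝ (Fin d)) (Y := EuclideanSpace ℝ (Fin d)))).tendsto ρ).comp hρ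
      have h2 := tendsto_nhds_unique h1 (hν.congr fun n => Subtype.ext (hπ n).2.symm)
      exact congrArg Subtype.val h2
  have hhalf : (0 : ℝ) < 1 / 2 := by norm_num
  have hcost : igwCost ρ ≤ c' ^ (1 / 2 : ℝ)⁻¹ := by
    refine igwCost_le_of_tendsto hρ ?_
    filter_upwards [hc] with n hn
    rw [ENNReal.le_rpow_inv_iff hhalf, igwCost_rpow_eq_gramDist]
    exact (hlt n hn).le
  rw [ENNReal.le_rpow_inv_iff hhalf, igwCost_rpow_eq_gramDist] at hcost
  rw [IGW_eq_iInf]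
  exact (iInf₂_le ρ hmem).trans hcost

/-- The second moment is controlled by the `L²` norm of the Gram kernel. -/
theorem sq_lintegral_enorm_sq_le (μ : P2 d) :
    (∫⁻ x, ‖x‖ₑ ^ 2 ∂μ.1.toMeasure) ^ 2 ≤
      d * eLpNorm (fun z : EuclideanSpace ℝ (Fin d) × EuclideanSpace ℝ (Fin d) =>
        (inner ℝ z.1 z.2 : ℝ)) 2 (μ.1.toMeasure.prod μ.1.toMeasure) ^ 2 := by
  set P := μ.1.toMeasure with hP
  have hid : MemLp (fun x : EuclideanSpace ℝ (Fin d) => x) 2 P :=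
    ⟨aestronglyMeasurable_id, eLpNorm_lt_top_of_map_eq measurable_id Measure.map_id⟩
  have hco : ∀ i, MemLp (fun x : EuclideanSpace ℝ (Fin d) => x i) 2 P := fun i =>
    hid.of_le (by fun_prop) (Eventually.of_forall fun x => PiLp.norm_apply_le x i)
  have hij : ∀ i j, Integrable (fun x : EuclideanSpace ℝ (Fin d) => x i * x j) P := fun i j =>
    (hco i).integrable_mul (hco j)
  have hm : ∀ i j, Integrable (fun z : EuclideanSpace ℝ (Fin d) × EuclideanSpace ℝ (Fin d) =>
      (z.1 i * z.1 j) * (z.2 i * z.2 j)) (P.prod P) := fun i j => (hij i j).mul_prod (hij i j)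
  have hexp : ∀ z : EuclideanSpace ℝ (Fin d) × EuclideanSpace ℝ (Fin d),
      (inner ℝ z.1 z.2 : ℝ) ^ 2 = ∑ i, ∑ j, (z.1 i * z.1 j) * (z.2 i * z.2 j) := by
    intro z
    rw [sq, PiLp.inner_apply, Finset.sum_mul_sum]
    refine Finset.sum_congr rfl fun i _ => Finset.sum_congr rfl fun j _ => ?_
    simp only [RCLike.inner_apply, conj_trivial]
    ring
  have hint : Integrable (fun z : EuclideanSpace ℝ (Fin d) × EuclideanSpace ℝ (Fin d) =>
      (inner ℝ z.1 z.2 : ℝ) ^ 2) (P.prod P) := by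
    simp_rw [hexp]
    exact integrable_finsetSum _ fun i _ => integrable_finsetSum _ fun j _ => hm i j
  have hval : ∫ z, (inner ℝ z.1 z.2 : ℝ) ^ 2 ∂(P.prod P) = ∑ i, ∑ j, (∫ x, x i * x j ∂P) ^ 2 := by
    simp_rw [hexp]
    rw [integral_finsetSum _ fun i _ => integrable_finsetSum _ fun j _ => hm i j]
    refine Finset.sum_congr rfl fun i _ => ?_
    rw [integral_finsetSum _ fun j _ => hm i j]
    refine Finset.sum_congr rfl fun j _ => ?_
    rw [integral_prod_mul (fun x : EuclideanSpace ℝ (Fin d) => x i * x j)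
      (fun x : EuclideanSpace ℝ (Fin d) => x i * x j), sq]
  have hnorm : ∫ x, ‖x‖ ^ 2 ∂P = ∑ i, ∫ x, x i * x i ∂P := by
    rw [← integral_finsetSum _ fun i _ => hij i i]
    refine integral_congr_ae (Eventually.of_forall fun x => ?_)
    simp only [EuclideanSpace.norm_sq_eq, Real.norm_eq_abs, sq_abs]
    simp only [sq]
  -- The left side is `(tr Σ)²` and the integral on the right is the squared Frobenius norm of `Σ`:
  -- apply Cauchy–Schwarz to the diagonal, then drop the off-diagonal terms.
  have hreal : (∫ x, ‖x‖ ^ 2 ∂P) ^ 2 ≤ d * ∫ z, (inner ℝ z.1 z.2 : ℝ) ^ 2 ∂(P.prod P) := by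
    rw [hnorm, hval]
    refine (sq_sum_le_card_mul_sum_sq (s := Finset.univ)).trans ?_
    rw [Finset.card_univ, Fintype.card_fin]
    gcongr with i
    exact Finset.single_le_sum (f := fun j => (∫ x, x i * x j ∂P) ^ 2)
      (fun j _ => sq_nonneg _) (Finset.mem_univ i)
  rw [← lintegral_enorm_sq_eq]
  have e1 : ∫⁻ x, ‖x‖ₑ ^ 2 ∂P = ENNReal.ofReal (∫ x, ‖x‖ ^ 2 ∂P) := by
    rw [ofReal_integral_eq_lintegral_ofReal hid.integrable_norm_pow'
      (Eventually.of_forall fun x => by positivity)]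
    refine lintegral_congr fun x => ?_
    rw [← ofReal_norm, ENNReal.ofReal_pow (norm_nonneg _)]
  have e2 : ∫⁻ z, ‖(inner ℝ z.1 z.2 : ℝ)‖ₑ ^ 2 ∂(P.prod P) =
      ENNReal.ofReal (∫ z, (inner ℝ z.1 z.2 : ℝ) ^ 2 ∂(P.prod P)) := by
    rw [ofReal_integral_eq_lintegral_ofReal hint (Eventually.of_forall fun x => by positivity)]
    refine lintegral_congr fun x => ?_
    rw [← ofReal_norm, ← ENNReal.ofReal_pow (norm_nonneg _), Real.norm_eq_abs, sq_abs]
  rw [e1, e2, ← ENNReal.ofReal_pow (by positivity), ← ENNReal.ofReal_natCast,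
    ← ENNReal.ofReal_mul (by positivity)]
  exact ENNReal.ofReal_le_ofReal hreal

/-- Balls of `IGW` have bounded second moments. -/
theorem exists_moment_bound (μ : P2 d) (C : ℝ≥0) :
    ∃ K : ℝ≥0, ∀ ν : P2 d, IGW μ ν ≤ C → ∫⁻ x, ‖x‖ₑ ^ 2 ∂ν.1.toMeasure ≤ K := by
  set N := eLpNorm (fun x : EuclideanSpace ℝ (Fin d) => x) 2 μ.1.toMeasure with hN
  have hNtop : N < ∞ := eLpNorm_lt_top_of_map_eq measurable_id Measure.map_id
  have hNN := eLpNorm_inner_prod_le μ.1.toMeasure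
    (A := fun x : EuclideanSpace ℝ (Fin d) => x) (B := fun x => x) measurable_id measurable_id
  rw [← hN] at hNN
  -- The final `+ 1` avoids a square root: a moment is either at most `1` or at most its square.
  set K : ℝ≥0∞ := d * (C + 1 + N * N) ^ 2 + 1 with hK
  have hKtop : K ≠ ∞ := by finiteness
  refine ⟨K.toNNReal, fun ν hν => ?_⟩
  rw [ENNReal.coe_toNNReal hKtop]
  obtain ⟨π, hπ, hlt⟩ := exists_coupling_gramDist_lt
    (hν.trans_lt (ENNReal.lt_add_right ENNReal.coe_ne_top one_ne_zero))
  have hG : eLpNorm (fun z : EuclideanSpace ℝ (Fin d) × EuclideanSpace ℝ (Fin d) =>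
        (inner ℝ z.1 z.2 : ℝ)) 2 (ν.1.toMeasure.prod ν.1.toMeasure) ≤ C + 1 + N * N := by
    -- Against the zero vector, `gramDist` is the norm of the Gram kernel, so its triangle
    -- inequality compares the two norms.
    let Z : EuclideanSpace ℝ (Fin d) → EuclideanSpace ℝ (Fin d) := fun _ => 0
    have hZ : Measurable Z := measurable_const
    have h0 : ∀ (m : Measure (EuclideanSpace ℝ (Fin d))),
        eLpNorm (fun z : EuclideanSpace ℝ (Fin d) × EuclideanSpace ℝ (Fin d) =>
        (inner ℝ z.1 z.2 : ℝ)) 2 (m.prod m) = gramDist m id Z := fun m => by simp [gramDist, Z]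
    have e1 : gramDist ν.1.toMeasure id Z = gramDist π.toMeasure Prod.snd (fun _ => 0) := by
      rw [← hπ.2, gramDist_map measurable_snd measurable_id hZ]
      rfl
    have e2 : gramDist μ.1.toMeasure id Z = gramDist π.toMeasure Prod.fst (fun _ => 0) := by
      rw [← hπ.1, gramDist_map measurable_fst measurable_id hZ]
      rfl
    rw [h0, e1]
    refine (gramDist_triangle _ measurable_snd measurable_fst measurable_const).trans ?_
    refine add_le_add (by rw [gramDist_comm]; exact hlt.le) ?_
    rw [← e2, ← h0]
    exact hNN
  have h2 : (∫⁻ x, ‖x‖ₑ ^ 2 ∂ν.1.toMeasure) ^ 2 ≤ d * (C + 1 + N * N) ^ 2 :=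
    (sq_lintegral_enorm_sq_le ν).trans (by gcongr)
  rcases le_total (∫⁻ x, ‖x‖ₑ ^ 2 ∂ν.1.toMeasure) 1 with h1 | h1
  · exact h1.trans le_add_self
  · have h3 := le_self_pow₀ h1 two_ne_zero
    exact (h3.trans h2).trans le_self_add

theorem exists_geodesic_dIGW (μ ν : P2 d) :
    ∃ ρ : I → P2 d, LipIGW ρ ∧ ρ 0 = μ ∧ ρ 1 = ν ∧ lengthIGW ρ = dIGW μ ν ∧
      ∀ s t : I, dIGW (ρ s) (ρ t) = edist s t * dIGW μ ν := by
  classical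
  let := igwPseudoEMetricSpace d
  let F : Ultrafilter ℕ := hyperfilter ℕ
  let Lim : (ℕ → P2 d) → P2 d := fun u =>
    if h : ∃ ν : P2 d, Tendsto (fun n => (u n).1) F (𝓝 ν.1) then h.choose else u 0
  have hLim : ∀ u, (∃ ν : P2 d, Tendsto (fun n => (u n).1) F (𝓝 ν.1)) →
      Tendsto (fun n => (u n).1) F (𝓝 (Lim u).1) := by
    intro u h
    simp only [Lim, dif_pos h]
    exact h.choose_spec
  refine exists_geodesic_of_generalizedLimit
    (fun u => ∃ K : ℝ≥0, ∀ n, ∫⁻ x, ‖x‖ₑ ^ 2 ∂(u n).1.toMeasure ≤ K) ?_ Lim ?_ ?_ μ ν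
    (dIGW_lt_top μ ν)
  · intro u x C h
    obtain ⟨K, hK⟩ := exists_moment_bound x C
    exact ⟨K, fun n => hK _ (h n)⟩
  · intro x
    exact Subtype.ext (tendsto_nhds_unique (hLim _ ⟨x, tendsto_const_nhds⟩) tendsto_const_nhds)
  · rintro u v ⟨K, hK⟩ ⟨K', hK'⟩ c hc
    exact IGW_le_of_tendsto hK hK' (hLim u (exists_tendsto_of_moment_le F u K hK))
      (hLim v (exists_tendsto_of_moment_le F v K' hK'))
      ((Nat.hyperfilter_le_atTop) hc)

end NarrowLimits

/-! ### Continuity at measures with nonsingular covariance -/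

section Continuity

variable {d : ℕ} {Ω : Type*} [MeasurableSpace Ω]

/-- The Hilbert–Schmidt bound for an integral operator: Cauchy–Schwarz in `ω'` for each `ω`, then
Tonelli. -/
theorem eLpNorm_integral_smul_le (P : Measure Ω) [SFinite P] {k : Ω × Ω → ℝ} (hk : Measurable k)
    {X : Ω → EuclideanSpace ℝ (Fin d)} (hX : Measurable X) :
    eLpNorm (fun ω => ∫ ω', k (ω, ω') • X ω' ∂P) 2 P ≤ eLpNorm k 2 (P.prod P) * eLpNorm X 2 P := by
  have hsq : (∫⁻ ω, ‖∫ ω', k (ω, ω') • X ω' ∂P‖ₑ ^ 2 ∂P) ≤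
      (eLpNorm k 2 (P.prod P) * eLpNorm X 2 P) ^ 2 := by
    calc (∫⁻ ω, ‖∫ ω', k (ω, ω') • X ω' ∂P‖ₑ ^ 2 ∂P)
        ≤ ∫⁻ ω, (∫⁻ ω', ‖k (ω, ω')‖ₑ ^ 2 ∂P) * eLpNorm X 2 P ^ 2 ∂P := by
          refine lintegral_mono fun ω => ?_
          have h1 : ‖∫ ω', k (ω, ω') • X ω' ∂P‖ₑ ≤
              eLpNorm (fun ω' => k (ω, ω')) 2 P * eLpNorm X 2 P := by
            refine (enorm_integral_le_lintegral_enorm _).trans ?_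
            simp only [eLpNorm_eq_lintegral_rpow_enorm_toReal (p := 2) two_ne_zero
              ENNReal.ofNat_ne_top, enorm_smul]
            have hk' : Measurable fun ω' => k (ω, ω') := hk.comp (by fun_prop)
            exact ENNReal.lintegral_mul_le_Lp_mul_Lq P (p := 2) (q := 2)
              (by simpa using Real.HolderConjugate.two_two) (by fun_prop) (by fun_prop)
          refine (pow_le_pow_left₀ zero_le h1 2).trans_eq ?_
          rw [mul_pow, ← lintegral_enorm_sq_eq P fun ω' => k (ω, ω')]
      _ = (eLpNorm k 2 (P.prod P) * eLpNorm X 2 P) ^ 2 := by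
          rw [lintegral_mul_const _ (by fun_prop), mul_pow, ← lintegral_enorm_sq_eq (P.prod P) k,
            lintegral_prod _ (by fun_prop)]
  rw [lintegral_enorm_sq_eq] at hsq
  exact (ENNReal.pow_le_pow_left_iff two_ne_zero).1 hsq

/-- The cross-covariance matrix of two random vectors. -/
noncomputable def crossCov (P : Measure Ω) (X Y : Ω → EuclideanSpace ℝ (Fin d)) :
    Matrix (Fin d) (Fin d) ℝ :=
  Matrix.of fun i j => ∫ ω, X ω i * Y ω j ∂P

theorem crossCov_self_eq_covMatrix {μ : P2 d} {P : Measure Ω} {X : Ω → EuclideanSpace ℝ (Fin d)}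
    (hX : Measurable X) (h : P.map X = (μ.1 : Measure _)) : crossCov P X X = covMatrix μ := by
  ext i j
  simp only [crossCov, covMatrix, Matrix.of_apply]
  rw [← h, integral_map hX.aemeasurable (by fun_prop)]

theorem toEuclideanCLM_crossCov_apply {P : Measure Ω} {X Y : Ω → EuclideanSpace ℝ (Fin d)}
    (hX : MemLp X 2 P) (hY : MemLp Y 2 P) (v : EuclideanSpace ℝ (Fin d)) :
    Integrable (fun ω => (inner ℝ v (Y ω) : ℝ) • X ω) P ∧
    Matrix.toEuclideanCLM (𝕜 := ℝ) (crossCov P X Y) v =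
      ∫ ω, (inner ℝ v (Y ω) : ℝ) • X ω ∂P := by
  have hvY : MemLp (fun ω => (inner ℝ v (Y ω) : ℝ)) 2 P := hY.const_inner v
  have hint : Integrable (fun ω => (inner ℝ v (Y ω) : ℝ) • X ω) P :=
    memLp_one_iff_integrable.1 (hX.smul hvY)
  have hcX : ∀ i, MemLp (fun ω => X ω i) 2 P := fun i =>
    hX.of_le ((EuclideanSpace.proj (𝕜 := ℝ) i).continuous.comp_aestronglyMeasurable hX.1)
      (Eventually.of_forall fun ω => PiLp.norm_apply_le (X ω) i)
  have hcY : ∀ i, MemLp (fun ω => Y ω i) 2 P := fun i =>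
    hY.of_le ((EuclideanSpace.proj (𝕜 := ℝ) i).continuous.comp_aestronglyMeasurable hY.1)
      (Eventually.of_forall fun ω => PiLp.norm_apply_le (Y ω) i)
  refine ⟨hint, ?_⟩
  ext i
  have h1 := (EuclideanSpace.proj i :
    EuclideanSpace ℝ (Fin d) →L[ℝ] ℝ).integral_comp_comm hint
  rw [EuclideanSpace.coe_proj] at h1
  refine Eq.trans ?_ h1
  rw [Matrix.ofLp_toEuclideanCLM]
  simp only [Matrix.mulVec, dotProduct, crossCov, Matrix.of_apply, PiLp.inner_apply,
    RCLike.inner_apply, conj_trivial, Finset.sum_mul, PiLp.smul_apply, smul_eq_mul]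
  rw [integral_finsetSum]
  · refine Finset.sum_congr rfl fun j _ => ?_
    rw [← integral_mul_const]
    congr 1; ext ω; ring
  · intro j _
    have := ((hcX i).integrable_mul (hcY j)).mul_const (v j)
    refine this.congr (Eventually.of_forall fun ω => ?_)
    simp only [Pi.mul_apply]
    ring

/-- If the Gram kernels of `X` and `Y` are `L²`-close and the covariance of `X` is nonsingular,
then `X` is `L²`-close to a linear image of `Y`. -/
theorem exists_linear_approximation {P : Measure Ω} [IsProbabilityMeasure P]
    {X Y : Ω → EuclideanSpace ℝ (Fin d)} (hXm : Measurable X) (hYm : Measurable Y)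
    (hX : MemLp X 2 P) (hY : MemLp Y 2 P) (hdet : IsUnit (crossCov P X X).det) :
    ∃ T : EuclideanSpace ℝ (Fin d) →L[ℝ] EuclideanSpace ℝ (Fin d),
      eLpNorm (T ∘ Y - X) 2 P ≤ ‖Matrix.toEuclideanCLM (𝕜 := ℝ) (crossCov P X X)⁻¹‖ₑ *
        (gramDist P X Y * eLpNorm X 2 P) := by
  let e := Matrix.toEuclideanCLM (n := Fin d) (𝕜 := ℝ)
  set A := crossCov P X X with hA
  refine ⟨e (A⁻¹ * crossCov P X Y), ?_⟩
  -- Integrating the kernel difference against `X` is linear in `X ω` and `Y ω`; applying `A⁻¹`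
  -- isolates `X ω`.
  let R : Ω → EuclideanSpace ℝ (Fin d) := fun ω => ∫ ω', (inner ℝ (X ω) (X ω') -
    inner ℝ (Y ω) (Y ω') : ℝ) • X ω' ∂P
  have hR : ∀ ω, R ω = e A (X ω) - e (crossCov P X Y) (Y ω) := by
    intro ω
    obtain ⟨i1, e1⟩ := toEuclideanCLM_crossCov_apply hX hX (X ω)
    obtain ⟨i2, e2⟩ := toEuclideanCLM_crossCov_apply hX hY (Y ω)
    simp only [R, e, hA, e1, e2, sub_smul]
    exact integral_sub i1 i2
  have hXY : ∀ ω, (e (A⁻¹ * crossCov P X Y) ∘ Y - X) ω = -(e A⁻¹ (R ω)) := by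
    intro ω
    have h1 : e A⁻¹ (e A (X ω)) = X ω := by
      rw [← mul_apply_eq_comp, ← map_mul, Matrix.nonsing_inv_mul _ hdet, map_one]
      rfl
    rw [hR, map_sub, h1, Pi.sub_apply, Function.comp_apply, map_mul, mul_apply_eq_comp]
    abel
  have hle : eLpNorm R 2 P ≤ gramDist P X Y * eLpNorm X 2 P :=
    eLpNorm_integral_smul_le P ((measurable_gram hXm).sub (measurable_gram hYm)) hXm
  calc eLpNorm (e (A⁻¹ * crossCov P X Y) ∘ Y - X) 2 P
      ≤ ENNReal.ofReal ‖e A⁻¹‖ * eLpNorm R 2 P := by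
        refine eLpNorm_le_mul_eLpNorm_of_ae_le_mul (Eventually.of_forall fun ω => ?_) 2
        rw [hXY, norm_neg]
        exact (e A⁻¹).le_opNorm _
    _ ≤ _ := by
        rw [ofReal_norm]
        exact mul_le_mul_right hle _

/-- The path passes through the law `ν` of `TY`. With `a = ‖Σ⁻¹‖ m` and `m` the `L²` norm of `X`,
the error `TY - X` has norm at most `a c`. The first two summands bound the leg from `μ` to `ν`, the
last the leg from `ν` to `μ₀`. -/
theorem dIGW_le_of_IGW_lt (μ₀ : P2 d) (h : (covMatrix μ₀).PosDef) :
    ∃ a m : ℝ≥0, ∀ (μ : P2 d) (c : ℝ≥0), IGW μ μ₀ < c →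
      dIGW μ μ₀ ≤ (c + a * c * (2 * m + a * c) + a * c * (2 * (m + a * c)) : ℝ≥0) := by
  set m := eLpNorm (fun x : EuclideanSpace ℝ (Fin d) => x) 2 μ₀.1.toMeasure with hm
  have hmtop : m < ∞ := eLpNorm_lt_top_of_map_eq measurable_id Measure.map_id
  set a := ‖Matrix.toEuclideanCLM (𝕜 := ℝ) (covMatrix μ₀)⁻¹‖ₑ * m with ha
  have hatop : a < ∞ := ENNReal.mul_lt_top enorm_lt_top hmtop
  refine ⟨a.toNNReal, m.toNNReal, fun μ c hc => ?_⟩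
  push_cast
  rw [ENNReal.coe_toNNReal hatop.ne, ENNReal.coe_toNNReal hmtop.ne]
  obtain ⟨π, hπ, hlt⟩ := exists_coupling_gramDist_lt hc
  set P := π.toMeasure with hP
  let E := EuclideanSpace ℝ (Fin d)
  have hXm : Measurable (Prod.snd : E × E → E) := measurable_snd
  have hYm : Measurable (Prod.fst : E × E → E) := measurable_fst
  have hX : MemLp (Prod.snd : E × E → E) 2 P :=
    ⟨hXm.aestronglyMeasurable, eLpNorm_lt_top_of_map_eq hXm hπ.2⟩
  have hY : MemLp (Prod.fst : E × E → E) 2 P :=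
    ⟨hYm.aestronglyMeasurable, eLpNorm_lt_top_of_map_eq hYm hπ.1⟩
  have hcov := crossCov_self_eq_covMatrix hXm hπ.2
  have hXnorm : eLpNorm (Prod.snd : E × E → E) 2 P = m := by
    rw [hm, ← hπ.2, eLpNorm_map_measure (by fun_prop) hXm.aemeasurable]
    rfl
  obtain ⟨T, hT⟩ := exists_linear_approximation hXm hYm hX hY
    (by rw [hcov]; exact h.det_pos.ne'.isUnit)
  rw [hcov, hXnorm] at hT
  have hTm : Measurable (T ∘ (Prod.fst : E × E → E)) := T.continuous.measurable.comp hYm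
  set η := eLpNorm (T ∘ (Prod.fst : E × E → E) - Prod.snd) 2 P with hη
  have hηle : η ≤ a * c := by
    refine hT.trans ?_
    rw [gramDist_comm, ha, mul_comm _ m, ← mul_assoc]
    gcongr
  have hTY : eLpNorm (T ∘ (Prod.fst : E × E → E)) 2 P ≤ m + η := by
    have := eLpNorm_add_le hXm.aestronglyMeasurable
      (hTm.sub hXm).aestronglyMeasurable one_le_two (μ := P)
    rw [hXnorm] at this
    simpa using this
  have hTYtop : eLpNorm (T ∘ (Prod.fst : E × E → E)) 2 P < ∞ := hTY.trans_lt
    (ENNReal.add_lt_top.2 ⟨hmtop, hηle.trans_lt (ENNReal.mul_lt_top hatop ENNReal.coe_lt_top)⟩)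
  let ν : P2 d := lawP2 P _ hTm hTYtop
  have h1 : dIGW μ ν ≤ c + a * c * (2 * m + a * c) := by
    refine (dIGW_le_gramDist_of_linear T ?_).trans ?_
    · rw [← hπ.1, Measure.map_map T.continuous.measurable hYm]
      rfl
    · rw [← hπ.1, gramDist_map hYm measurable_id T.continuous.measurable]
      refine (gramDist_triangle P hYm hXm hTm).trans (add_le_add hlt.le ?_)
      rw [gramDist_comm]
      refine (gramDist_le P hTm hXm).trans ?_
      rw [hXnorm]
      calc η * (eLpNorm (T ∘ (Prod.fst : E × E → E)) 2 P + m) ≤ η * (m + η + m) := by gcongr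
        _ = η * (2 * m + η) := by ring
        _ ≤ _ := by gcongr
  have h2 : dIGW μ₀ ν ≤ a * c * (2 * (m + a * c)) := by
    refine (dIGW_le_eLpNorm hXm hTm hπ.2 rfl).trans ?_
    rw [hXnorm]
    gcongr
  calc dIGW μ μ₀ ≤ dIGW μ ν + dIGW ν μ₀ := dIGW_triangle _ _ _
    _ ≤ _ := add_le_add h1 (by rw [dIGW_comm]; exact h2)

theorem tendsto_dIGW (μ₀ : P2 d) (h : (covMatrix μ₀).PosDef) :
    Tendsto (fun μ : P2 d => dIGW μ μ₀) (comap (fun μ : P2 d => IGW μ μ₀) (𝓝 0)) (𝓝 0) := by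
  obtain ⟨a, m, hle⟩ := dIGW_le_of_IGW_lt μ₀ h
  rw [ENNReal.tendsto_nhds_zero]
  intro ε hε
  let g : ℝ≥0 → ℝ≥0 := fun c => c + a * c * (2 * m + a * c) + a * c * (2 * (m + a * c))
  have hg : Tendsto (fun c => (g c : ℝ≥0∞)) (𝓝[>] 0) (𝓝 0) := by
    have hgc : Continuous fun c => (g c : ℝ≥0∞) :=
      ENNReal.continuous_coe.comp (by fun_prop)
    have := hgc.tendsto 0
    simp only [g, mul_zero, zero_mul, add_zero, ENNReal.coe_zero] at this
    exact this.mono_left nhdsWithin_le_nhds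
  obtain ⟨c, hc, hc0⟩ := ((hg.eventually_le_const hε).and self_mem_nhdsWithin).exists
  have : ∀ᶠ x : ℝ≥0∞ in 𝓝 0, x < c := eventually_lt_nhds (ENNReal.coe_pos.2 hc0)
  filter_upwards [this.comap _] with μ hμ
  exact (hle μ c hμ).trans hc

end Continuity

theorem mainTheorem3 (d : ℕ) :
    -- `dIGW` is a finite pseudometric on `P2 d`, vanishing exactly when `IGW` vanishes
    ((∀ μ ν : P2 d, dIGW μ ν < ∞) ∧
      (∀ μ : P2 d, dIGW μ μ = 0) ∧
      (∀ μ ν : P2 d, dIGW μ ν = dIGW ν μ) ∧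
      (∀ μ ν ξ : P2 d, dIGW μ ξ ≤ dIGW μ ν + dIGW ν ξ) ∧
      (∀ μ ν : P2 d, dIGW μ ν = 0 ↔ IGW μ ν = 0)) ∧
    -- geodesics: minimizing Lipschitz curves exist, and may be taken of constant speed
    (∀ μ₀ μ₁ : P2 d, ∃ ρ : I → P2 d, LipIGW ρ ∧ ρ 0 = μ₀ ∧ ρ 1 = μ₁ ∧
      lengthIGW ρ = dIGW μ₀ μ₁ ∧
      ∀ s t : I, dIGW (ρ s) (ρ t) = edist s t * dIGW μ₀ μ₁) ∧
    -- `dIGW μ μ₀ → 0` as `IGW μ μ₀ → 0`, if the covariance of `μ₀` is nonsingular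
    (∀ μ₀ : P2 d, (covMatrix μ₀).PosDef →
      Tendsto (fun μ : P2 d => dIGW μ μ₀) (comap (fun μ : P2 d => IGW μ μ₀) (𝓝 0)) (𝓝 0)) := by
  exact ⟨⟨dIGW_lt_top, fun μ => (dIGW_eq_zero_iff μ μ).2 (IGW_self μ), dIGW_comm, dIGW_triangle,
    dIGW_eq_zero_iff⟩, exists_geodesic_dIGW, tendsto_dIGW⟩
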